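/- Let $V_4$ be a $4$-dimensional complex vector space with a fixed basis $e_1,\dots,e_4$. For $A\in\wedge^2V_4$ denote by the same letter its skew-symmetric coordinate matrix ($x\wedge y\mapsto (x_iy_j-x_jy_i)$), and let $A^*$ be the dual skew-symmetric matrix, $A^*_{ij}=\frac12\sum_{k,l}\varepsilon_{ijkl}A_{kl}$, with $\varepsilon_{ijkl}$ the Levi-Civita symbol. Define a linear map on $\wedge^3(\wedge^2V_4)$ by $\omega\mapsto (v(\omega),w(\omega))$, where for $\omega=A_1\wedge A_2\wedge A_3$ $$v(\omega)=\sum_{\sigma\in S_3}\mathrm{sgn}(\sigma)\,A_{\sigma(1)}A_{\sigma(2)}^*A_{\sigma(3)},\qquad w(\omega)=\sum_{\sigma\in S_3}\mathrm{sgn}(\sigma)\,A_{\sigma(1)}^*A_{\sigma(2)}A_{\sigma(3)}^*.$$ (0) (Double spin decomposition.) This map is a linear isomorphism of $\wedge^3(\wedge^2V_4)$ onto the space $S^2V_4\oplus S^2V_4^*$ of pairs of symmetric $4\times4$ matrices, and for $g\in GL(V_4)$ with matrix $G$ one has $v(g\omega)=\det(G)\,G\,v(\omega)\,G^{T}$ and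 $w(g\omega)=\det(G)^2\,(G^{-1})^{T}w(\omega)\,G^{-1}$; in particular it is an isomorphism of $sl(V_4)$-modules. Use the entries $v_{ij}=v_{ji}$, $w_{ij}=w_{ji}$ as homogeneous coordinates $[v,w]$ on $\mathbb{P}(S^2V_4\oplus S^2V_4^*)$, and embed $\mathrm{G}(3,\wedge^2V_4)$, the Grassmannian of $3$-dimensional subspaces $U\subset\wedge^2V_4$, by sending $U$ to the image of the line $\wedge^3U$. Let $I_G\subset\mathbb{C}[v_{ij},w_{ij}]$ be the (Plücker) ideal of all polynomials that vanish on the affine cone over the image. Let $\mathcal{I}=\{\{i<j\}\mid 1\le i<j\le4\}$; for $I\in\mathcal{I}$ let $\check I$ be the complement of $I$ in $\{1,2,3,4\}$, and let $\epsilon_{I\check I}$ be the signature of the permutation given by the sequence $I$ followed by $\check I$, each in increasing order. For a $4\times4$ matrix $m$ let $|m_{IJ}|$ be the $2\times2$ minor with rows $I$ and columns $J$. (1) The ideal $I_G$ is generated by $$|v_{IJ}|-\epsilon_{I\check I}\,\epsilon_{J\check J}\,|w_{\check I\check J}|\quad(I,J\in\mathcal{I}),\qquad (v\cdot w)_{ij},\quad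 (v\cdot w)_{ii}-(v\cdot w)_{jj}\quad(i\neq j,\ 1\le i,j\le 4).$$ (2) The points of $V(I_G)\subset\mathbb{P}(S^2V_4\oplus S^2V_4^*)$ are exactly the points of the embedded Grassmannian: a point $[v,w]$ lies in $V(I_G)$ if and only if it is the image of a unique $U\in\mathrm{G}(3,\wedge^2V_4)$. (3) Every $[v,w]\in V(I_G)$ satisfies: $\det v=\det w$; $v\cdot w=c\cdot\mathrm{id}_4$ for some $c\in\mathbb{C}$ with $c^2=\det w$, i.e. $v\cdot w=\pm\sqrt{\det w}\,\mathrm{id}_4$; $\mathrm{rk}\,v\neq3$ and $\mathrm{rk}\,w\neq3$; $\mathrm{rk}\,v=2\Leftrightarrow\mathrm{rk}\,w=2$; and $\mathrm{rk}\,v\le1\Leftrightarrow\mathrm{rk}\,w\le1$. -/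

import Mathlib

open scoped Matrix

noncomputable section

namespace DoubleSpin

/-! ### Index pairs, signatures and minors -/

/-- The index set of pairs `{i, j}` with `i < j` in a four-element set. -/
abbrev IdxPair : Type := {p : Fin 4 × Fin 4 // p.1 < p.2}

/-- The underlying set of an index pair. -/
def IdxPair.toFinset (I : IdxPair) : Finset (Fin 4) := {I.1.1, I.1.2}

/-- The dual index pair: the increasing pair formed by the two elements not in `I`. -/
def dualIdx (I : IdxPair) : IdxPair :=
  ⟨((I.toFinsetᶜ).min' (by revert I; decide), (I.toFinsetᶜ).max' (by revert I; decide)),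
    by revert I; decide⟩

/-- The signature of the ordered union of `I` and `J`, i.e. of the sequence
`(i₁, i₂, j₁, j₂)` seen as a permutation (and `0` if it is not a permutation). -/
def epsilon (I J : IdxPair) : ℤ :=
  if h : Function.Bijective ![I.1.1, I.1.2, J.1.1, J.1.2] then
    (Equiv.Perm.sign (Equiv.ofBijective _ h) : ℤ)
  else 0

/-- The `2 × 2` minor of `M` with rows `I` and columns `J`. -/
def minor {R : Type*} [CommRing R] (M : Matrix (Fin 4) (Fin 4) R) (I J : IdxPair) : R :=
  (M.submatrix ![I.1.1, I.1.2] ![J.1.1, J.1.2]).det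

/-! ### The double spin decomposition of `⋀³(⋀²V)` in a basis `b` of `V` -/

section Spin

variable {V : Type*} [AddCommGroup V] [Module ℂ V]

/-- The skew-symmetric coordinate matrix of a bivector; `x ∧ y` goes to
`(xᵢ yⱼ - xⱼ yᵢ)ᵢⱼ`. -/
def bivectorMatrix (b : Module.Basis (Fin 4) ℂ V) :
    ⋀[ℂ]^2 V →ₗ[ℂ] Matrix (Fin 4) (Fin 4) ℂ where
  toFun x := Matrix.of fun i j =>
    exteriorPower.pairingDual ℂ V 2 (exteriorPower.ιMulti ℂ 2 ![b.coord i, b.coord j]) x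
  map_add' x y := by ext i j; simp
  map_smul' c x := by ext i j; simp

/-- The map `A ↦ A*` with `A*ᵢⱼ = ½ ∑ ε(i,j,k,l) Aₖₗ` for a skew-symmetric matrix `A`: the
isomorphism `⋀²V ≃ ⋀²V*` given by the volume form of the basis. -/
def hodge : Matrix (Fin 4) (Fin 4) ℂ →ₗ[ℂ] Matrix (Fin 4) (Fin 4) ℂ where
  toFun A :=
    !![0, A 2 3, -A 1 3, A 1 2;
       -A 2 3, 0, A 0 3, -A 0 2;
       A 1 3, -A 0 3, 0, A 0 1;
       -A 1 2, A 0 2, -A 0 1, 0]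
  map_add' A B := by
    ext i j; fin_cases i <;> fin_cases j <;> simp <;> ring
  map_smul' c A := by
    ext i j; fin_cases i <;> fin_cases j <;> simp

/-- The component `⋀³(⋀²V) → S²V`: the linear map sending `A₁ ∧ A₂ ∧ A₃` to
`∑_σ sgn(σ) A_σ₁ A_σ₂* A_σ₃` (a symmetric matrix). -/
def spinV (b : Module.Basis (Fin 4) ℂ V) :
    ⋀[ℂ]^3 (⋀[ℂ]^2 V) →ₗ[ℂ] Matrix (Fin 4) (Fin 4) ℂ :=
  exteriorPower.alternatingMapLinearEquiv <| MultilinearMap.alternatization <|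
    (MultilinearMap.mkPiAlgebraFin ℂ 3 (Matrix (Fin 4) (Fin 4) ℂ)).compLinearMap
      ![bivectorMatrix b, hodge ∘ₗ bivectorMatrix b, bivectorMatrix b]

/-- The component `⋀³(⋀²V) → S²V*`: the linear map sending `A₁ ∧ A₂ ∧ A₃` to
`∑_σ sgn(σ) A_σ₁* A_σ₂ A_σ₃*` (a symmetric matrix). -/
def spinW (b : Module.Basis (Fin 4) ℂ V) :
    ⋀[ℂ]^3 (⋀[ℂ]^2 V) →ₗ[ℂ] Matrix (Fin 4) (Fin 4) ℂ :=
  exteriorPower.alternatingMapLinearEquiv <| MultilinearMap.alternatization <|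
    (MultilinearMap.mkPiAlgebraFin ℂ 3 (Matrix (Fin 4) (Fin 4) ℂ)).compLinearMap
      ![hodge ∘ₗ bivectorMatrix b, bivectorMatrix b, hodge ∘ₗ bivectorMatrix b]

/-- The line `⋀³U ⊆ ⋀³(⋀²V)` of a three-dimensional subspace `U ⊆ ⋀²V`, spanned by the
products `u₁ ∧ u₂ ∧ u₃` of vectors of `U`. -/
def pluckerLine (U : Submodule ℂ (⋀[ℂ]^2 V)) : Submodule ℂ (⋀[ℂ]^3 (⋀[ℂ]^2 V)) :=
  Submodule.span ℂ
    (Set.range fun u : Fin 3 → U => exteriorPower.ιMulti ℂ 3 fun i => (u i : ⋀[ℂ]^2 V))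

end Spin

/-! ### Homogeneous coordinates on `ℙ(S²V ⊕ S²V*)` -/

/-- Index set of the twenty coordinates `v_{ij} = v_{ji}` and `w_{ij} = w_{ji}`. -/
abbrev CoordIdx : Type := Sym2 (Fin 4) ⊕ Sym2 (Fin 4)

/-- The generic symmetric matrix of the coordinates `v_{ij}`. -/
def genV : Matrix (Fin 4) (Fin 4) (MvPolynomial CoordIdx ℂ) :=
  Matrix.of fun i j => MvPolynomial.X (Sum.inl s(i, j))

/-- The generic symmetric matrix of the coordinates `w_{ij}`. -/
def genW : Matrix (Fin 4) (Fin 4) (MvPolynomial CoordIdx ℂ) :=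
  Matrix.of fun i j => MvPolynomial.X (Sum.inr s(i, j))

/-- The coordinate vector of a pair of symmetric matrices: `v_{ij}` with `i ≤ j`, followed by
`w_{ij}` with `i ≤ j`. -/
def coords (v w : Matrix (Fin 4) (Fin 4) ℂ) : CoordIdx → ℂ :=
  Sum.elim (fun s => v s.inf s.sup) (fun s => w s.inf s.sup)

/-- The affine cone over the image of `G(3, ⋀²V)` in `ℙ(S²V ⊕ S²V*)`. -/
def grassmannianCone {V : Type*} [AddCommGroup V] [Module ℂ V]
    (b : Module.Basis (Fin 4) ℂ V) : Set (CoordIdx → ℂ) :=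
  {a | ∃ U : Submodule ℂ (⋀[ℂ]^2 V), Module.finrank ℂ U = 3 ∧
    ∃ ω ∈ pluckerLine U, a = coords (spinV b ω) (spinW b ω)}

/-- The Plücker ideal of `G(3, ⋀²V)` in double spin coordinates: all polynomials that vanish on
the affine cone over the embedded Grassmannian. -/
def pluckerIdeal {V : Type*} [AddCommGroup V] [Module ℂ V]
    (b : Module.Basis (Fin 4) ℂ V) : Ideal (MvPolynomial CoordIdx ℂ) :=
  MvPolynomial.vanishingIdeal ℂ (grassmannianCone b)

/-- The explicit quadratic relations between `v` and `w`. -/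
def spinRelations : Set (MvPolynomial CoordIdx ℂ) :=
  {q | ∃ I J : IdxPair, q = minor genV I J -
      ((epsilon I (dualIdx I) * epsilon J (dualIdx J) : ℤ) : MvPolynomial CoordIdx ℂ) *
        minor genW (dualIdx I) (dualIdx J)} ∪
  {q | ∃ i j : Fin 4, i ≠ j ∧ q = (genV * genW) i j} ∪
  {q | ∃ i j : Fin 4, i ≠ j ∧ q = (genV * genW) i i - (genV * genW) j j}

end DoubleSpin

end

open scoped Matrix

noncomputable section

namespace DoubleSpin

/-! ### Coordinates on the second exterior power -/

/-! Everything is transported to Plücker coordinates. In the basis `e_i ∧ e_k` of `⋀²V` a trivector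
has 20 coordinates indexed by triples in `Fin 6`, and on decomposable trivectors these are the
maximal minors of a `3 × 6` matrix. The double spin map is then an explicit linear change of
coordinates (`vMat`, `wMat`), inverted by `plucker` up to the factor 6. This gives the isomorphism;
equivariance follows from `hodge (G A Gᵀ) = det G • G⁻ᵀ (hodge A) G⁻¹`.

Under this change of coordinates the quadrics in `v` and `w` have the same span as the 35
straightening relations of `G(3, 6)`, one for each incomparable pair of triples
(`SpinRel.isStraight`, `IsStraight.spinRel`). One direction shows that the quadrics vanish on the
Grassmannian. The other shows that, modulo the quadrics, every polynomial is a combination of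
standard monomials (`exists_mem_standardSpan_aeval_eq`). Standard monomials in the minors of a
generic matrix have distinct leading exponents, hence are linearly independent
(`eq_zero_of_aeval_maxMinors_genMatrix_eq_zero`). So a polynomial vanishing on the cone has zero
standard form and lies in the ideal of the quadrics (`pluckerIdeal_eq_span`).

For the points, a cubic identity of Cramer type holds on decomposable trivectors, hence on the zero
locus of the ideal, where it exhibits `ω` as decomposable (`exists_eq_smul_of_mem_zeroLocus`); a
nonzero decomposable trivector determines its subspace (`eq_of_mem_exteriorLine`). The determinant
and rank statements follow from the quadrics by Laplace expansion, Cauchy–Binet and Sylvester's rank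
inequality. -/

/-- The first index of the `j`-th pair `i < k` in lexicographic order. -/
def pairFst : Fin 6 → Fin 4 := ![0, 0, 0, 1, 1, 2]

/-- The second index of the `j`-th pair `i < k` in lexicographic order. -/
def pairSnd : Fin 6 → Fin 4 := ![1, 2, 3, 2, 3, 3]

/-- The increasing triples of elements of `Fin 6`, in lexicographic order. -/
def tri : Fin 20 → Fin 3 → Fin 6 :=
  ![![0, 1, 2], ![0, 1, 3], ![0, 1, 4], ![0, 1, 5], ![0, 2, 3], ![0, 2, 4], ![0, 2, 5],
    ![0, 3, 4], ![0, 3, 5], ![0, 4, 5], ![1, 2, 3], ![1, 2, 4], ![1, 2, 5], ![1, 3, 4],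
    ![1, 3, 5], ![1, 4, 5], ![2, 3, 4], ![2, 3, 5], ![2, 4, 5], ![3, 4, 5]]

theorem exists_tri_eq (f : Fin 3 → Fin 6) (hf : StrictMono f) : ∃ t, tri t = f := by
  have key : ∀ i j k : Fin 6, i < j → j < k → ∃ t, tri t = ![i, j, k] := by decide
  obtain ⟨t, ht⟩ := key (f 0) (f 1) (f 2) (hf (by decide)) (hf (by decide))
  refine ⟨t, ht.trans ?_⟩
  ext i
  fin_cases i <;> rfl

theorem sum_perm_fin_three {E : Type*} [AddCommGroup E] (F : Fin 3 → Fin 3 → Fin 3 → E) :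
    ∑ σ : Equiv.Perm (Fin 3), Equiv.Perm.sign σ • F (σ 0) (σ 1) (σ 2) =
      F 0 1 2 - F 0 2 1 - F 1 0 2 + F 1 2 0 + F 2 0 1 - F 2 1 0 := by
  have h : (Finset.univ : Finset (Equiv.Perm (Fin 3))) =
      {1, Equiv.swap 1 2, Equiv.swap 0 1, finRotate 3, (finRotate 3)⁻¹, Equiv.swap 0 2} := by
    decide
  have s1 : Equiv.Perm.sign (Equiv.swap (1 : Fin 3) 2) = -1 := by decide
  have s2 : Equiv.Perm.sign (Equiv.swap (0 : Fin 3) 1) = -1 := by decide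
  have s3 : Equiv.Perm.sign (finRotate 3) = 1 := by decide
  have s4 : Equiv.Perm.sign (finRotate 3)⁻¹ = 1 := by decide
  have s5 : Equiv.Perm.sign (Equiv.swap (0 : Fin 3) 2) = -1 := by decide
  rw [h, Finset.sum_insert (by decide), Finset.sum_insert (by decide),
    Finset.sum_insert (by decide), Finset.sum_insert (by decide), Finset.sum_insert (by decide),
    Finset.sum_singleton, s1, s2, s3, s4, s5, Equiv.Perm.sign_one]
  have e : ∀ i j k i' j' k' : Fin 3, i = i' → j = j' → k = k' → F i j k = F i' j' k' := by
    rintro _ _ _ _ _ _ rfl rfl rfl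
    rfl
  rw [e ((1 : Equiv.Perm (Fin 3)) 0) _ _ 0 1 2 (by decide) (by decide) (by decide),
    e (Equiv.swap (1 : Fin 3) 2 0) _ _ 0 2 1 (by decide) (by decide) (by decide),
    e (Equiv.swap (0 : Fin 3) 1 0) _ _ 1 0 2 (by decide) (by decide) (by decide),
    e (finRotate 3 0) _ _ 1 2 0 (by decide) (by decide) (by decide),
    e ((finRotate 3)⁻¹ 0) _ _ 2 0 1 (by decide) (by decide) (by decide),
    e (Equiv.swap (0 : Fin 3) 2 0) _ _ 2 1 0 (by decide) (by decide) (by decide)]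
  simp only [one_smul, Units.neg_smul]
  abel

section

variable {V : Type*} [AddCommGroup V] [Module ℂ V] (b : Module.Basis (Fin 4) ℂ V)

theorem bivectorMatrix_ιMulti (x : Fin 2 → V) (i j : Fin 4) :
    bivectorMatrix b (exteriorPower.ιMulti ℂ 2 x) i j =
      b.coord i (x 0) * b.coord j (x 1) - b.coord j (x 0) * b.coord i (x 1) := by
  simp [bivectorMatrix, exteriorPower.pairingDual_ιMulti_ιMulti, Matrix.det_fin_two]

theorem bivectorMatrix_transpose (x : ⋀[ℂ]^2 V) :
    (bivectorMatrix b x)ᵀ = -bivectorMatrix b x := by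
  have h : (Matrix.transposeLinearEquiv (Fin 4) (Fin 4) ℂ ℂ).toLinearMap ∘ₗ bivectorMatrix b =
      -bivectorMatrix b := by
    apply exteriorPower.linearMap_ext
    ext x i j
    simp [bivectorMatrix_ιMulti]
  exact LinearMap.congr_fun h x

/-- The basis `e_i ∧ e_k`, `i < k`, of `⋀²V`. -/
def bivectorBasis : Module.Basis (Fin 6) ℂ (⋀[ℂ]^2 V) :=
  haveI : Module.Finite ℂ V := Module.Finite.of_basis b
  basisOfLinearIndependentOfCardEqFinrank
    (b := fun j => exteriorPower.ιMulti ℂ 2 ![b (pairFst j), b (pairSnd j)])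
    -- The dual functionals are the entries of the coordinate matrix above the diagonal.
    (LinearIndependent.of_pairwise_dual_eq_zero_one _
      (fun j => LinearMap.proj (pairSnd j) ∘ₗ LinearMap.proj (pairFst j) ∘ₗ
        (Matrix.ofLinearEquiv ℂ).symm.toLinearMap ∘ₗ bivectorMatrix b)
      (by
        intro i j hij
        revert hij
        fin_cases i <;> fin_cases j <;>
          simp [bivectorMatrix_ιMulti, pairFst, pairSnd])
      (by
        intro i
        fin_cases i <;> simp [bivectorMatrix_ιMulti, pairFst, pairSnd]))
    (by rw [exteriorPower.finrank_eq, Module.finrank_eq_card_basis b]; simp; decide)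

theorem bivectorBasis_coord (j : Fin 6) (x : ⋀[ℂ]^2 V) :
    (bivectorBasis b).coord j x = bivectorMatrix b x (pairFst j) (pairSnd j) := by
  have h : (bivectorBasis b).coord j = LinearMap.proj (pairSnd j) ∘ₗ LinearMap.proj (pairFst j) ∘ₗ
        (Matrix.ofLinearEquiv ℂ).symm.toLinearMap ∘ₗ bivectorMatrix b := by
    refine (bivectorBasis b).ext fun i => ?_
    rw [Module.Basis.coord_apply, Module.Basis.repr_self]
    simp only [bivectorBasis, coe_basisOfLinearIndependentOfCardEqFinrank]
    fin_cases i <;> fin_cases j <;>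
          simp [bivectorMatrix_ιMulti, pairFst, pairSnd]
  rw [h]
  rfl

/-- The skew-symmetric matrix with prescribed entries above the diagonal. -/
def skew (a : Fin 6 → ℂ) : Matrix (Fin 4) (Fin 4) ℂ :=
  !![0, a 0, a 1, a 2; -a 0, 0, a 3, a 4; -a 1, -a 3, 0, a 5; -a 2, -a 4, -a 5, 0]

theorem bivectorMatrix_eq_skew (x : ⋀[ℂ]^2 V) :
    bivectorMatrix b x = skew fun j => (bivectorBasis b).coord j x := by
  have h : ∀ i j, bivectorMatrix b x j i = -bivectorMatrix b x i j := fun i j =>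
    congrFun (congrFun (bivectorMatrix_transpose b x) i) j
  have h0 : ∀ i, bivectorMatrix b x i i = 0 := fun i => self_eq_neg.mp (h i i)
  ext i j
  simp only [bivectorBasis_coord]
  fin_cases i <;> fin_cases j <;> simp [skew, pairFst, pairSnd, h0] <;> exact h _ _

theorem hodge_skew (a : Fin 6 → ℂ) :
    hodge (skew a) = skew ![a 5, -a 4, a 3, a 2, -a 1, a 0] := by
  ext i j
  fin_cases i <;> fin_cases j <;> simp [hodge, skew]

/-- The alternating sum of the products of three matrices, with the second one taken from `N`. -/
def altProd (M N : Fin 3 → Matrix (Fin 4) (Fin 4) ℂ) : Matrix (Fin 4) (Fin 4) ℂ :=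
  M 0 * N 1 * M 2 - M 0 * N 2 * M 1 - M 1 * N 0 * M 2 + M 1 * N 2 * M 0 + M 2 * N 0 * M 1 -
    M 2 * N 1 * M 0

theorem spinV_ιMulti (u : Fin 3 → ⋀[ℂ]^2 V) :
    spinV b (exteriorPower.ιMulti ℂ 3 u) =
      altProd (fun i => bivectorMatrix b (u i)) (fun i => hodge (bivectorMatrix b (u i))) := by
  rw [spinV, exteriorPower.alternatingMapLinearEquiv_apply_ιMulti,
    MultilinearMap.alternatization_apply, altProd, ← sum_perm_fin_three fun i j k =>
      bivectorMatrix b (u i) * hodge (bivectorMatrix b (u j)) * bivectorMatrix b (u k)]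
  refine Finset.sum_congr rfl fun σ _ => ?_
  simp [mul_assoc, List.ofFn_succ]

theorem spinW_ιMulti (u : Fin 3 → ⋀[ℂ]^2 V) :
    spinW b (exteriorPower.ιMulti ℂ 3 u) =
      altProd (fun i => hodge (bivectorMatrix b (u i))) (fun i => bivectorMatrix b (u i)) := by
  rw [spinW, exteriorPower.alternatingMapLinearEquiv_apply_ιMulti,
    MultilinearMap.alternatization_apply, altProd, ← sum_perm_fin_three fun i j k =>
      hodge (bivectorMatrix b (u i)) * bivectorMatrix b (u j) * hodge (bivectorMatrix b (u k))]
  refine Finset.sum_congr rfl fun σ _ => ?_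
  simp [mul_assoc, List.ofFn_succ]

end

/-! ### From Plücker coordinates to pairs of symmetric matrices and back -/

section

variable {A : Type*} [CommRing A]

/-- The symmetric matrix `v` with Plücker coordinates `p`. -/
def vMat (p : Fin 20 → A) : Matrix (Fin 4) (Fin 4) A :=
  !![6 * p 0, 3 * (p 2 - p 4), 3 * (p 3 - p 10), 3 * (p 6 - p 11);
     3 * (p 2 - p 4), 6 * p 7, 3 * (p 8 + p 13), 3 * (p 9 + p 16);
     3 * (p 3 - p 10), 3 * (p 8 + p 13), 6 * p 14, 3 * (p 15 + p 17);
     3 * (p 6 - p 11), 3 * (p 9 + p 16), 3 * (p 15 + p 17), 6 * p 18]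

/-- The symmetric matrix `w` with Plücker coordinates `p`. -/
def wMat (p : Fin 20 → A) : Matrix (Fin 4) (Fin 4) A :=
  !![6 * p 19, 3 * (p 17 - p 15), 3 * (p 9 - p 16), 3 * (p 13 - p 8);
     3 * (p 17 - p 15), 6 * p 12, 3 * (-p 6 - p 11), 3 * (p 3 + p 10);
     3 * (p 9 - p 16), 3 * (-p 6 - p 11), 6 * p 5, 3 * (-p 2 - p 4);
     3 * (p 13 - p 8), 3 * (p 3 + p 10), 3 * (-p 2 - p 4), 6 * p 1]

/-- Six times the Plücker coordinates of a pair of symmetric matrices. -/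
def plucker (v w : Matrix (Fin 4) (Fin 4) A) : Fin 20 → A :=
  ![v 0 0, w 3 3, v 0 1 - w 2 3, v 0 2 + w 1 3, -v 0 1 - w 2 3, w 2 2, v 0 3 - w 1 2, v 1 1,
    v 1 2 - w 0 3, v 1 3 + w 0 2, -v 0 2 + w 1 3, -v 0 3 - w 1 2, w 1 1, v 1 2 + w 0 3,
    v 2 2, v 2 3 - w 0 1, v 1 3 - w 0 2, v 2 3 + w 0 1, v 3 3, w 0 0]

theorem vMat_isSymm (p : Fin 20 → A) : (vMat p).IsSymm := by
  ext i j
  fin_cases i <;> fin_cases j <;> rfl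

theorem wMat_isSymm (p : Fin 20 → A) : (wMat p).IsSymm := by
  ext i j
  fin_cases i <;> fin_cases j <;> rfl

theorem plucker_vMat_wMat (p : Fin 20 → A) (t : Fin 20) :
    plucker (vMat p) (wMat p) t = 6 * p t := by
  fin_cases t <;> simp [plucker, vMat, wMat] <;> ring

theorem vMat_plucker {v w : Matrix (Fin 4) (Fin 4) A} (hv : v.IsSymm) :
    vMat (plucker v w) = (6 : A) • v := by
  ext i j
  fin_cases i <;> fin_cases j <;>
    simp [plucker, vMat, hv.apply 0 1, hv.apply 0 2, hv.apply 0 3, hv.apply 1 2, hv.apply 1 3,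
      hv.apply 2 3] <;> ring

theorem wMat_plucker {v w : Matrix (Fin 4) (Fin 4) A} (hw : w.IsSymm) :
    wMat (plucker v w) = (6 : A) • w := by
  ext i j
  fin_cases i <;> fin_cases j <;>
    simp [plucker, wMat, hw.apply 0 1, hw.apply 0 2, hw.apply 0 3, hw.apply 1 2, hw.apply 1 3,
      hw.apply 2 3] <;> ring

/-- The maximal minors of a `3 × 6` matrix. -/
def maxMinors (M : Matrix (Fin 3) (Fin 6) A) (t : Fin 20) : A := (M.submatrix id (tri t)).det

end

/-! ### The double spin map in Plücker coordinates. -/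

theorem mul_mul_apply_four {A : Type*} [CommRing A] (L M N : Matrix (Fin 4) (Fin 4) A)
    (i j : Fin 4) :
    (L * M * N) i j =
      (L i 0 * M 0 0 + L i 1 * M 1 0 + L i 2 * M 2 0 + L i 3 * M 3 0) * N 0 j +
      (L i 0 * M 0 1 + L i 1 * M 1 1 + L i 2 * M 2 1 + L i 3 * M 3 1) * N 1 j +
      (L i 0 * M 0 2 + L i 1 * M 1 2 + L i 2 * M 2 2 + L i 3 * M 3 2) * N 2 j +
      (L i 0 * M 0 3 + L i 1 * M 1 3 + L i 2 * M 2 3 + L i 3 * M 3 3) * N 3 j := by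
  simp [Matrix.mul_apply, Fin.sum_univ_four]

-- A polynomial identity in the 18 entries of `M`: the alternating sum is trilinear and alternating
-- in the rows, so it can only involve maximal minors. This is where the coefficients of `vMat` come
-- from.
set_option maxHeartbeats 1000000 in
theorem altProd_skew_hodge (M : Matrix (Fin 3) (Fin 6) ℂ) :
    altProd (fun i => skew (M i)) (fun i => hodge (skew (M i))) = vMat (maxMinors M) := by
  simp only [hodge_skew]
  ext i j
  simp only [altProd, Matrix.add_apply, Matrix.sub_apply, mul_mul_apply_four]
  fin_cases i <;> fin_cases j <;>
    simp [skew, vMat, maxMinors, tri, Matrix.det_fin_three] <;> ring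

set_option maxHeartbeats 1000000 in
theorem altProd_hodge_skew (M : Matrix (Fin 3) (Fin 6) ℂ) :
    altProd (fun i => hodge (skew (M i))) (fun i => skew (M i)) = wMat (maxMinors M) := by
  simp only [hodge_skew]
  ext i j
  simp only [altProd, Matrix.add_apply, Matrix.sub_apply, mul_mul_apply_four]
  fin_cases i <;> fin_cases j <;>
    simp [skew, wMat, maxMinors, tri, Matrix.det_fin_three] <;> ring

section

variable {V : Type*} [AddCommGroup V] [Module ℂ V] (b : Module.Basis (Fin 4) ℂ V)

/-- The coordinate matrix of a triple of bivectors. -/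
def coordMatrix (u : Fin 3 → ⋀[ℂ]^2 V) : Matrix (Fin 3) (Fin 6) ℂ :=
  Matrix.of fun i j => (bivectorBasis b).coord j (u i)

/-- The Plücker coordinates on `⋀³(⋀²V)`. -/
def pluckerCoord (J : Fin 3 → Fin 6) : ⋀[ℂ]^3 (⋀[ℂ]^2 V) →ₗ[ℂ] ℂ :=
  exteriorPower.pairingDual ℂ (⋀[ℂ]^2 V) 3
    (exteriorPower.ιMulti ℂ 3 fun i => (bivectorBasis b).coord (J i))

theorem pluckerCoord_ιMulti (J : Fin 3 → Fin 6) (u : Fin 3 → ⋀[ℂ]^2 V) :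
    pluckerCoord b J (exteriorPower.ιMulti ℂ 3 u) = ((coordMatrix b u).submatrix id J).det := by
  rw [pluckerCoord, exteriorPower.pairingDual_ιMulti_ιMulti]
  rfl

theorem spinV_ιMulti_eq_vMat (u : Fin 3 → ⋀[ℂ]^2 V) :
    spinV b (exteriorPower.ιMulti ℂ 3 u) = vMat (maxMinors (coordMatrix b u)) := by
  rw [spinV_ιMulti, ← altProd_skew_hodge]
  simp only [bivectorMatrix_eq_skew]
  rfl

theorem spinW_ιMulti_eq_wMat (u : Fin 3 → ⋀[ℂ]^2 V) :
    spinW b (exteriorPower.ιMulti ℂ 3 u) = wMat (maxMinors (coordMatrix b u)) := by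
  rw [spinW_ιMulti, ← altProd_hodge_skew]
  simp only [bivectorMatrix_eq_skew]
  rfl

/-- Induction principle for `⋀³(⋀²V)`. -/
theorem exteriorPower_induction {R M : Type*} [CommRing R] [AddCommGroup M] [Module R M] {n : ℕ}
    {p : ⋀[R]^n M → Prop} (ω : ⋀[R]^n M)
    (h : ∀ u, p (exteriorPower.ιMulti R n u)) (h0 : p 0)
    (hadd : ∀ x y, p x → p y → p (x + y)) (hsmul : ∀ (c : R) x, p x → p (c • x)) : p ω := by
  have hω : ω ∈ Submodule.span R (Set.range (exteriorPower.ιMulti R n (M := M))) := by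
    rw [exteriorPower.ιMulti_span]
    trivial
  induction hω using Submodule.span_induction with
  | mem x hx => obtain ⟨u, rfl⟩ := hx; exact h u
  | zero => exact h0
  | add x y _ _ hx hy => exact hadd x y hx hy
  | smul c x _ hx => exact hsmul c x hx

theorem spinV_isSymm (ω : ⋀[ℂ]^3 (⋀[ℂ]^2 V)) : (spinV b ω).IsSymm := by
  induction ω using exteriorPower_induction with
  | h u => rw [spinV_ιMulti_eq_vMat]; exact vMat_isSymm _
  | h0 => rw [map_zero]; exact Matrix.isSymm_zero
  | hadd x y hx hy => rw [map_add]; exact hx.add hy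
  | hsmul c x hx => rw [map_smul]; exact hx.smul c

theorem spinW_isSymm (ω : ⋀[ℂ]^3 (⋀[ℂ]^2 V)) : (spinW b ω).IsSymm := by
  induction ω using exteriorPower_induction with
  | h u => rw [spinW_ιMulti_eq_wMat]; exact wMat_isSymm _
  | h0 => rw [map_zero]; exact Matrix.isSymm_zero
  | hadd x y hx hy => rw [map_add]; exact hx.add hy
  | hsmul c x hx => rw [map_smul]; exact hx.smul c

theorem plucker_add {A : Type*} [CommRing A] (v w v' w' : Matrix (Fin 4) (Fin 4) A) :
    plucker (v + v') (w + w') = plucker v w + plucker v' w' := by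
  ext t
  fin_cases t <;> simp [plucker] <;> ring

theorem plucker_smul {A : Type*} [CommRing A] (c : A) (v w : Matrix (Fin 4) (Fin 4) A) :
    plucker (c • v) (c • w) = c • plucker v w := by
  ext t
  fin_cases t <;> simp [plucker] <;> ring

/-- Both sides are linear in `ω`, so the computation on decomposable trivectors suffices. The factor
6 avoids the denominators of the inverse change of coordinates. -/
theorem plucker_spin (ω : ⋀[ℂ]^3 (⋀[ℂ]^2 V)) :
    plucker (spinV b ω) (spinW b ω) = fun t => 6 * pluckerCoord b (tri t) ω := by
  induction ω using exteriorPower_induction with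
  | h u =>
    ext t
    rw [spinV_ιMulti_eq_vMat, spinW_ιMulti_eq_wMat, plucker_vMat_wMat, pluckerCoord_ιMulti]
    rfl
  | h0 =>
    have := plucker_smul (0 : ℂ) (0 : Matrix (Fin 4) (Fin 4) ℂ) 0
    simp only [zero_smul] at this
    simp only [map_zero, this]
    ext t; simp
  | hadd x y hx hy => rw [map_add, map_add, plucker_add, hx, hy]; ext t; simp; ring
  | hsmul c x hx => rw [map_smul, map_smul, plucker_smul, hx]; ext t; simp; ring

/-! ### Bijectivity of the double spin map. -/

theorem eq_zero_of_pluckerCoord_eq_zero {ω : ⋀[ℂ]^3 (⋀[ℂ]^2 V)}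
    (h : ∀ t, pluckerCoord b (tri t) ω = 0) : ω = 0 := by
  refine ((bivectorBasis b).exteriorPower 3).ext_elem fun s => ?_
  obtain ⟨t, ht⟩ := exists_tri_eq _ (Set.powersetCard.ofFinEmbEquiv.symm s).strictMono
  rw [map_zero, Finsupp.zero_apply, exteriorPower.basis_repr_apply, ← h t, ht]
  rfl

/-- The double spin decomposition, in coordinates. -/
def spinCoords : ⋀[ℂ]^3 (⋀[ℂ]^2 V) →ₗ[ℂ] (CoordIdx → ℂ) where
  toFun ω := coords (spinV b ω) (spinW b ω)
  map_add' x y := by ext (s | s) <;> simp [coords]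
  map_smul' c x := by ext (s | s) <;> simp [coords]

theorem coords_inl (v w : Matrix (Fin 4) (Fin 4) ℂ) (hv : v.IsSymm) (i j : Fin 4) :
    coords v w (Sum.inl s(i, j)) = v i j := by
  rcases le_total i j with h | h <;> simp [coords, h, hv.apply i j]

theorem coords_inr (v w : Matrix (Fin 4) (Fin 4) ℂ) (hw : w.IsSymm) (i j : Fin 4) :
    coords v w (Sum.inr s(i, j)) = w i j := by
  rcases le_total i j with h | h <;> simp [coords, h, hw.apply i j]

theorem coords_injective {v w v' w' : Matrix (Fin 4) (Fin 4) ℂ} (hv : v.IsSymm) (hw : w.IsSymm)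
    (hv' : v'.IsSymm) (hw' : w'.IsSymm) (h : coords v w = coords v' w') : v = v' ∧ w = w' := by
  constructor <;> ext i j
  · rw [← coords_inl v w hv, h, coords_inl v' w' hv']
  · rw [← coords_inr v w hw, h, coords_inr v' w' hw']

theorem spin_injective : Function.Injective
    (fun ω : ⋀[ℂ]^3 (⋀[ℂ]^2 V) => (spinV b ω, spinW b ω)) := by
  intro x y h
  obtain ⟨h1, h2⟩ := Prod.ext_iff.mp h
  refine sub_eq_zero.mp (eq_zero_of_pluckerCoord_eq_zero b fun t => ?_)
  have := congrFun (plucker_spin b x) t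
  simp only at h1 h2
  rw [h1, h2, plucker_spin] at this
  rw [map_sub, sub_eq_zero]
  exact (mul_left_cancel₀ (by norm_num) this).symm

theorem spinCoords_injective : Function.Injective (spinCoords b) := by
  intro x y h
  obtain ⟨h1, h2⟩ := coords_injective (spinV_isSymm b x) (spinW_isSymm b x) (spinV_isSymm b y)
    (spinW_isSymm b y) h
  exact spin_injective b (Prod.ext h1 h2)

/-- Both sides have dimension 20: the binomial coefficient of 6 over 3, and twice the number of
unordered pairs in `Fin 4`. -/
theorem spinCoords_surjective : Function.Surjective (spinCoords b) := by
  have : Module.Finite ℂ V := Module.Finite.of_basis b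
  refine (LinearMap.injective_iff_surjective_of_finrank_eq_finrank ?_).mp (spinCoords_injective b)
  rw [exteriorPower.finrank_eq, Module.finrank_eq_card_basis (bivectorBasis b)]
  simp [Sym2.card]
  decide

theorem range_spin : Set.range (fun ω : ⋀[ℂ]^3 (⋀[ℂ]^2 V) => (spinV b ω, spinW b ω)) =
    {p | p.1.IsSymm ∧ p.2.IsSymm} := by
  apply Set.Subset.antisymm
  · rintro _ ⟨ω, rfl⟩
    exact ⟨spinV_isSymm b ω, spinW_isSymm b ω⟩
  · rintro ⟨v, w⟩ ⟨hv, hw⟩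
    obtain ⟨ω, hω⟩ := spinCoords_surjective b (coords v w)
    obtain ⟨h1, h2⟩ := coords_injective (spinV_isSymm b ω) (spinW_isSymm b ω) hv hw hω
    exact ⟨ω, Prod.ext h1 h2⟩

/-! ### Equivariance -/

theorem bivectorMatrix_map (f : V →ₗ[ℂ] V) (x : ⋀[ℂ]^2 V) :
    bivectorMatrix b (exteriorPower.map 2 f x) =
      LinearMap.toMatrix b b f * bivectorMatrix b x * (LinearMap.toMatrix b b f)ᵀ := by
  have hf : ∀ y i, b.repr (f y) i = ∑ k, LinearMap.toMatrix b b f i k * b.repr y k := by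
    intro y i
    have := congrFun (LinearMap.toMatrix_mulVec_repr b b f y) i
    rw [← this]
    rfl
  induction x using exteriorPower_induction with
  | h u =>
    ext i j
    rw [exteriorPower.map_apply_ιMulti, bivectorMatrix_ιMulti]
    simp only [Module.Basis.coord_apply, Function.comp_apply, hf, Matrix.mul_apply,
      Matrix.transpose_apply, bivectorMatrix_ιMulti, Fin.sum_univ_four]
    ring
  | h0 => simp
  | hadd x y hx hy => simp only [map_add, hx, hy, Matrix.mul_add, Matrix.add_mul]
  | hsmul c x hx => simp only [map_smul, hx, Matrix.mul_smul, Matrix.smul_mul]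

-- `hodge` encodes the wedge pairing on `⋀²V` with values in `⋀⁴V`, which `G` scales by its
-- determinant. Stating it without inverses makes it a polynomial identity.
set_option maxHeartbeats 4000000 in
theorem transpose_mul_hodge_mul (G : Matrix (Fin 4) (Fin 4) ℂ) (a : Fin 6 → ℂ) :
    Gᵀ * hodge (G * skew a * Gᵀ) * G = G.det • hodge (skew a) := by
  -- `G` acts on `⋀²V` through its `2 × 2` minors; the identity then reduces to Laplace expansions
  -- of `det G`.
  have hs : G * skew a * Gᵀ = skew fun j => ∑ k, a k *
      (G (pairFst j) (pairFst k) * G (pairSnd j) (pairSnd k) -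
        G (pairFst j) (pairSnd k) * G (pairSnd j) (pairFst k)) := by
    ext i j
    fin_cases i <;> fin_cases j <;>
      simp [skew, Matrix.mul_apply, Fin.sum_univ_succ, pairFst, pairSnd] <;> ring
  rw [hs, hodge_skew, hodge_skew]
  ext i j
  rw [Matrix.smul_apply, Matrix.det_succ_row_zero, mul_mul_apply_four]
  fin_cases i <;> fin_cases j <;>
    simp [skew, Fin.sum_univ_succ, pairFst, pairSnd, Matrix.det_fin_three, Fin.succAbove] <;> ring
theorem hodge_mul_mul_transpose (G : Matrix (Fin 4) (Fin 4) ℂ) (hG : IsUnit G.det) (a : Fin 6 → ℂ) :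
    hodge (G * skew a * Gᵀ) = G.det • ((G⁻¹)ᵀ * hodge (skew a) * G⁻¹) := by
  have h := transpose_mul_hodge_mul G a
  have h1 : (G⁻¹)ᵀ * Gᵀ = 1 := by
    rw [← Matrix.transpose_mul, Matrix.mul_nonsing_inv G hG, Matrix.transpose_one]
  calc hodge (G * skew a * Gᵀ)
      = ((G⁻¹)ᵀ * Gᵀ) * hodge (G * skew a * Gᵀ) * (G * G⁻¹) := by
        rw [h1, Matrix.mul_nonsing_inv G hG, Matrix.one_mul, Matrix.mul_one]
    _ = (G⁻¹)ᵀ * (Gᵀ * hodge (G * skew a * Gᵀ) * G) * G⁻¹ := by simp only [Matrix.mul_assoc]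
    _ = _ := by rw [h, Matrix.mul_smul, Matrix.smul_mul]

/-- `M` transforms contravariantly to `N`, so the inner factors of each triple product cancel. -/
theorem altProd_conj (M N : Fin 3 → Matrix (Fin 4) (Fin 4) ℂ) (P Q R : Matrix (Fin 4) (Fin 4) ℂ)
    (S : Matrix (Fin 4) (Fin 4) ℂ) (h : Q * R = 1) (h' : S * P = 1) :
    altProd (fun i => P * M i * Q) (fun i => R * N i * S) = P * altProd M N * Q := by
  have key : ∀ i j k, P * M i * Q * (R * N j * S) * (P * M k * Q) = P * (M i * N j * M k) * Q := by
    intro i j k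
    calc _ = P * M i * (Q * R) * N j * (S * P) * M k * Q := by simp only [Matrix.mul_assoc]
      _ = _ := by rw [h, h']; simp only [Matrix.mul_assoc, Matrix.one_mul]
  simp only [altProd, key, Matrix.mul_add, Matrix.mul_sub, Matrix.add_mul, Matrix.sub_mul]

/-- Each term has two factors from `M` and one from `N`. As only the `hodge` factors acquire `det
G`, this yields `det G` for `v` and its square for `w`. -/
theorem altProd_smul (M N : Fin 3 → Matrix (Fin 4) (Fin 4) ℂ) (c d : ℂ) :
    altProd (fun i => c • M i) (fun i => d • N i) = (c ^ 2 * d) • altProd M N := by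
  simp only [altProd, Matrix.mul_smul, Matrix.smul_mul, smul_smul, smul_add, smul_sub]
  ring_nf

theorem spin_equivariant (g : V ≃ₗ[ℂ] V) (ω : ⋀[ℂ]^3 (⋀[ℂ]^2 V)) :
    spinV b (exteriorPower.map 3 (exteriorPower.map 2 g.toLinearMap) ω) =
      (LinearMap.toMatrix b b g.toLinearMap).det • (LinearMap.toMatrix b b g.toLinearMap *
        spinV b ω * (LinearMap.toMatrix b b g.toLinearMap)ᵀ) ∧
    spinW b (exteriorPower.map 3 (exteriorPower.map 2 g.toLinearMap) ω) =
      (LinearMap.toMatrix b b g.toLinearMap).det ^ 2 •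
        (((LinearMap.toMatrix b b g.toLinearMap)⁻¹)ᵀ * spinW b ω *
          (LinearMap.toMatrix b b g.toLinearMap)⁻¹) := by
  have hG : IsUnit (LinearMap.toMatrix b b g.toLinearMap).det := LinearEquiv.isUnit_det g b b
  have hmap := bivectorMatrix_map b g.toLinearMap
  set G := LinearMap.toMatrix b b g.toLinearMap with hGdef
  have h1 : G⁻¹ * G = 1 := Matrix.nonsing_inv_mul G hG
  have h2 : Gᵀ * (G⁻¹)ᵀ = 1 := by rw [← Matrix.transpose_mul, h1, Matrix.transpose_one]
  induction ω using exteriorPower_induction with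
  | h u =>
    rw [exteriorPower.map_apply_ιMulti, spinV_ιMulti, spinW_ιMulti, spinV_ιMulti, spinW_ιMulti]
    have hh : ∀ x, hodge (G * bivectorMatrix b x * Gᵀ) =
        G.det • ((G⁻¹)ᵀ * hodge (bivectorMatrix b x) * G⁻¹) := fun x => by
      rw [bivectorMatrix_eq_skew]
      exact hodge_mul_mul_transpose G hG _
    simp only [Function.comp_apply, hmap, hh]
    constructor
    · have := altProd_smul (fun i => G * bivectorMatrix b (u i) * Gᵀ)
        (fun i => (G⁻¹)ᵀ * hodge (bivectorMatrix b (u i)) * G⁻¹) 1 G.det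
      simp only [one_smul, one_pow, one_mul] at this
      rw [this, altProd_conj _ _ _ _ _ _ h2 h1]
    · have := altProd_smul (fun i => (G⁻¹)ᵀ * hodge (bivectorMatrix b (u i)) * G⁻¹)
        (fun i => G * bivectorMatrix b (u i) * Gᵀ) G.det 1
      simp only [one_smul, mul_one] at this
      rw [this, altProd_conj _ _ _ _ _ _ h1 h2]
  | h0 => simp
  | hadd x y hx hy =>
    simp only [map_add, hx.1, hx.2, hy.1, hy.2, Matrix.mul_add, Matrix.add_mul, smul_add, and_self]
  | hsmul c x hx =>
    simp only [map_smul, hx.1, hx.2, Matrix.mul_smul, Matrix.smul_mul, smul_comm c, and_self]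

end

/-! ### The relations and straightening -/

/-- The sign of the sequence `I` followed by its complement, for the `k`-th index pair `I`. -/
def pairSign {A : Type*} [CommRing A] : Fin 6 → A := ![1, -1, 1, 1, -1, 1]

/-- The `2 × 2` minor with rows the `k`-th and columns the `l`-th index pair. -/
def pairMinor {A : Type*} [CommRing A] (M : Matrix (Fin 4) (Fin 4) A) (k l : Fin 6) : A :=
  M (pairFst k) (pairFst l) * M (pairSnd k) (pairSnd l) -
    M (pairFst k) (pairSnd l) * M (pairSnd k) (pairFst l)

/-- The relations between the two components of a decomposable trivector. -/
structure SpinRel {A : Type*} [CommRing A] (v w : Matrix (Fin 4) (Fin 4) A) : Prop where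
  minor : ∀ k l, pairMinor v k l = pairSign k * pairSign l * pairMinor w (5 - k) (5 - l)
  offDiag : ∀ i j, i ≠ j → (v * w) i j = 0
  diag : ∀ i j, i ≠ j → (v * w) i i = (v * w) j j

/-- The straightening relations: an entry `(a, b, l)` expresses the product of the Plücker
coordinates `a` and `b` as the sum of the products in `l`. -/
def straightening : List (Fin 20 × Fin 20 × List (ℤ × Fin 20 × Fin 20)) := [
    (2, 4, [(-1, 0, 7), (1, 1, 5)]), (2, 10, [(-1, 0, 13), (1, 1, 11)]),
    (3, 4, [(-1, 0, 8), (1, 1, 6)]), (3, 5, [(-1, 0, 9), (1, 2, 6)]),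
    (3, 7, [(-1, 1, 9), (1, 2, 8)]), (3, 10, [(-1, 0, 14), (1, 1, 12)]),
    (3, 11, [(-1, 0, 15), (1, 2, 12)]), (3, 13, [(-1, 1, 15), (1, 2, 14)]),
    (3, 16, [(1, 0, 19), (-1, 1, 18), (1, 2, 17)]), (5, 10, [(-1, 0, 16), (1, 4, 11)]),
    (6, 7, [(-1, 4, 9), (1, 5, 8)]), (6, 10, [(-1, 0, 17), (1, 4, 12)]),
    (6, 11, [(-1, 0, 18), (1, 5, 12)]), (6, 13, [(-1, 0, 19), (-1, 4, 15), (1, 5, 14)]),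
    (6, 16, [(-1, 4, 18), (1, 5, 17)]), (7, 10, [(-1, 1, 16), (1, 4, 13)]),
    (7, 11, [(-1, 2, 16), (1, 5, 13)]),
    (7, 12, [(-1, 0, 19), (1, 1, 18), (-1, 2, 17), (-1, 4, 15), (1, 5, 14)]),
    (8, 10, [(-1, 1, 17), (1, 4, 14)]), (8, 11, [(-1, 0, 19), (-1, 2, 17), (1, 5, 14)]),
    (8, 12, [(-1, 3, 17), (1, 6, 14)]), (8, 13, [(-1, 1, 19), (1, 7, 14)]),
    (8, 16, [(-1, 4, 19), (1, 7, 17)]), (9, 10, [(1, 0, 19), (-1, 1, 18), (1, 4, 15)]),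
    (9, 11, [(-1, 2, 18), (1, 5, 15)]), (9, 12, [(-1, 3, 18), (1, 6, 15)]),
    (9, 13, [(-1, 2, 19), (1, 7, 15)]), (9, 14, [(-1, 3, 19), (1, 8, 15)]),
    (9, 16, [(-1, 5, 19), (1, 7, 18)]), (9, 17, [(-1, 6, 19), (1, 8, 18)]),
    (12, 13, [(-1, 10, 15), (1, 11, 14)]), (12, 16, [(-1, 10, 18), (1, 11, 17)]),
    (14, 16, [(-1, 10, 19), (1, 13, 17)]), (15, 16, [(-1, 11, 19), (1, 13, 18)]),
    (15, 17, [(-1, 12, 19), (1, 14, 18)])]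

/-- A family satisfying the straightening relations. -/
def IsStraight {A : Type*} [CommRing A] (P : Fin 20 → A) : Prop :=
  ∀ e ∈ straightening, P e.1 * P e.2.1 =
    (e.2.2.map fun t => (t.1 : A) * P t.2.1 * P t.2.2).sum

section

variable {A : Type*} [CommRing A]

theorem forall_mem_straightening_iff {p : Fin 20 × Fin 20 × List (ℤ × Fin 20 × Fin 20) → Prop} :
    (∀ e ∈ straightening, p e) ↔ straightening.Forall p := List.forall_iff_forall_mem.symm

theorem isStraight_maxMinors (M : Matrix (Fin 3) (Fin 6) A) : IsStraight (maxMinors M) := by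
  rw [IsStraight, forall_mem_straightening_iff]
  simp only [straightening, List.Forall, maxMinors, tri, Matrix.det_fin_three]
  refine ⟨?_, ?_, ?_, ?_, ?_, ?_, ?_, ?_, ?_, ?_, ?_, ?_, ?_, ?_, ?_, ?_, ?_, ?_, ?_, ?_, ?_, ?_, ?_, ?_, ?_, ?_, ?_, ?_, ?_, ?_, ?_, ?_, ?_, ?_, ?_⟩ <;> simp <;> ring

/-- Each straightening relation is a combination of the relations in `v` and `w` with coefficients
`±1`. No division occurs, so this also applies to the generic matrices modulo the ideal of the
relations. -/
theorem SpinRel.isStraight {v w : Matrix (Fin 4) (Fin 4) A} (hv : v.IsSymm) (hw : w.IsSymm)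
    (h : SpinRel v w) : IsStraight (plucker v w) := by
  have m00 := h.minor 0 0
  have m01 := h.minor 0 1
  have m02 := h.minor 0 2
  have m03 := h.minor 0 3
  have m04 := h.minor 0 4
  have m05 := h.minor 0 5
  have m11 := h.minor 1 1
  have m12 := h.minor 1 2
  have m13 := h.minor 1 3
  have m14 := h.minor 1 4
  have m15 := h.minor 1 5
  have m22 := h.minor 2 2
  have m23 := h.minor 2 3
  have m24 := h.minor 2 4
  have m25 := h.minor 2 5
  have m33 := h.minor 3 3
  have m34 := h.minor 3 4
  have m35 := h.minor 3 5
  have m44 := h.minor 4 4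
  have m45 := h.minor 4 5
  have m55 := h.minor 5 5
  have o01 := h.offDiag 0 1 (by decide)
  have o02 := h.offDiag 0 2 (by decide)
  have o03 := h.offDiag 0 3 (by decide)
  have o10 := h.offDiag 1 0 (by decide)
  have o12 := h.offDiag 1 2 (by decide)
  have o13 := h.offDiag 1 3 (by decide)
  have o20 := h.offDiag 2 0 (by decide)
  have o21 := h.offDiag 2 1 (by decide)
  have o23 := h.offDiag 2 3 (by decide)
  have o30 := h.offDiag 3 0 (by decide)
  have o31 := h.offDiag 3 1 (by decide)
  have o32 := h.offDiag 3 2 (by decide)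
  have d1 := h.diag 0 1 (by decide)
  have d2 := h.diag 0 2 (by decide)
  have d3 := h.diag 0 3 (by decide)
  simp only [pairMinor, pairSign, pairFst, pairSnd, Matrix.mul_apply, Fin.sum_univ_four,
    hv.apply 0 1, hv.apply 0 2, hv.apply 0 3, hv.apply 1 2, hv.apply 1 3, hv.apply 2 3,
    hw.apply 0 1, hw.apply 0 2, hw.apply 0 3, hw.apply 1 2, hw.apply 1 3, hw.apply 2 3,
    Fin.reduceSub, Matrix.cons_val]
    at
      m00 m01 m02 m03 m04 m05 m11 m12 m13 m14 m15 m22 m23 m24 m25 m33 m34 m35 m44 m45 m55 o01 o02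
      o03 o10 o12 o13 o20 o21 o23 o30 o31 o32 d1 d2 d3
  rw [IsStraight, forall_mem_straightening_iff]
  simp only [straightening, List.Forall, List.map_cons, List.map_nil, List.sum_cons, List.sum_nil,
    plucker, Matrix.cons_val]
  push_cast
  refine ⟨?_, ?_, ?_, ?_, ?_, ?_, ?_, ?_, ?_, ?_, ?_, ?_, ?_, ?_, ?_, ?_, ?_, ?_, ?_, ?_, ?_, ?_, ?_, ?_, ?_, ?_, ?_, ?_, ?_, ?_, ?_, ?_, ?_, ?_, ?_⟩
  · linear_combination m00
  · linear_combination m01 + o03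
  · linear_combination m01 - o03
  · linear_combination m02 + o02
  · linear_combination -m03 + o13
  · linear_combination m11
  · linear_combination m12 - o01
  · linear_combination -m13 + o23
  · linear_combination -m23 - d3
  · linear_combination m02 - o02
  · linear_combination -m04 - o12
  · linear_combination m12 + o01
  · linear_combination m22
  · linear_combination -m14 + d2
  · linear_combination -m24 - o32
  · linear_combination m03 + o13
  · linear_combination m04 - o12
  · linear_combination -d1 + d2 + d3
  · linear_combination m13 + o23
  · linear_combination m14 + d2
  · linear_combination m15 + o21
  · linear_combination -m33
  · linear_combination -m34 - o10
  · linear_combination m23 - d3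
  · linear_combination m24 - o32
  · linear_combination m25 + o31
  · linear_combination -m34 + o10
  · linear_combination -m35 + o20
  · linear_combination -m44
  · linear_combination -m45 + o30
  · linear_combination -m15 + o21
  · linear_combination -m25 + o31
  · linear_combination -m35 - o20
  · linear_combination -m45 - o30
  · linear_combination -m55

theorem pairMinor_comm {M : Matrix (Fin 4) (Fin 4) A} (hM : M.IsSymm) (k l : Fin 6) :
    pairMinor M k l = pairMinor M l k := by
  simp only [pairMinor]
  rw [hM.apply (pairFst l), hM.apply (pairSnd l), hM.apply (pairFst l) (pairSnd k),
    hM.apply (pairSnd l) (pairFst k)]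
  ring

/-- Converse change of basis between the two families of quadrics; the factors 18 and 36 come from
the entries 3 and 6 of `vMat` and `wMat`. -/
theorem IsStraight.spinRel {P : Fin 20 → A} (h : IsStraight P) : SpinRel (vMat P) (wMat P) := by
  rw [IsStraight, forall_mem_straightening_iff] at h
  simp only [straightening, List.Forall, List.map_cons, List.map_nil, List.sum_cons, List.sum_nil]
    at h
  push_cast at h
  obtain ⟨r0, r1, r2, r3, r4, r5, r6, r7, r8, r9, r10, r11, r12, r13, r14, r15, r16, r17, r18, r19,
    r20, r21, r22, r23, r24, r25, r26, r27, r28, r29, r30, r31, r32, r33, r34⟩ := h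
  have hm : ∀ k l, k ≤ l → pairMinor (vMat P) k l =
      pairSign k * pairSign l * pairMinor (wMat P) (5 - k) (5 - l) := by
    intro k l
    fin_cases k <;> fin_cases l <;>
      simp [pairMinor, pairSign, pairFst, pairSnd, vMat, wMat]
    · linear_combination 36 * r0
    · linear_combination 18 * r1 + 18 * r2
    · linear_combination 18 * r3 + 18 * r9
    · linear_combination -18 * r4 + 18 * r15
    · linear_combination -18 * r10 + 18 * r16
    · linear_combination 18 * r8 - 18 * r13 + 18 * r19 - 18 * r23
    · linear_combination 36 * r5
    · linear_combination 18 * r6 + 18 * r11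
    · linear_combination -18 * r7 + 18 * r18
    · linear_combination -18 * r13 + 18 * r19
    · linear_combination 18 * r20 - 18 * r30
    · linear_combination 36 * r12
    · linear_combination -18 * r8 + 18 * r23
    · linear_combination -18 * r14 + 18 * r24
    · linear_combination 18 * r25 - 18 * r31
    · linear_combination -36 * r21
    · linear_combination -18 * r22 - 18 * r26
    · linear_combination -18 * r27 - 18 * r32
    · linear_combination -36 * r28
    · linear_combination -18 * r29 - 18 * r33
    · linear_combination -36 * r34
  have hd : ∀ i, (vMat P * wMat P) 0 0 = (vMat P * wMat P) i i := by
    intro i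
    fin_cases i <;> simp [vMat, wMat, Matrix.mul_apply, Fin.sum_univ_four]
    · linear_combination -18 * r8 + 18 * r13 - 36 * r17 + 18 * r19 - 18 * r23
    · linear_combination 18 * r13 + 18 * r19
    · linear_combination -18 * r8 - 18 * r23
  refine ⟨fun k l => ?_, fun i j => ?_, fun i j _ => (hd i).symm.trans (hd j)⟩
  · rcases le_total k l with hkl | hkl
    · exact hm k l hkl
    · rw [pairMinor_comm (vMat_isSymm P), pairMinor_comm (wMat_isSymm P), hm l k hkl,
        mul_comm (pairSign l)]
  · fin_cases i <;> fin_cases j <;> simp [vMat, wMat, Matrix.mul_apply, Fin.sum_univ_four]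
    · linear_combination -18 * r6 + 18 * r11
    · linear_combination 18 * r3 - 18 * r9
    · linear_combination 18 * r1 - 18 * r2
    · linear_combination -18 * r22 + 18 * r26
    · linear_combination -18 * r10 - 18 * r16
    · linear_combination 18 * r4 + 18 * r15
    · linear_combination 18 * r27 - 18 * r32
    · linear_combination 18 * r20 + 18 * r30
    · linear_combination 18 * r7 + 18 * r18
    · linear_combination 18 * r29 - 18 * r33
    · linear_combination 18 * r25 + 18 * r31
    · linear_combination -18 * r14 - 18 * r24

end

/-! ### The explicit relations -/

/-- The `k`-th index pair in lexicographic order. -/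
def idxPair (k : Fin 6) : IdxPair := ⟨(pairFst k, pairSnd k), by revert k; decide⟩

theorem exists_idxPair_eq (I : IdxPair) : ∃ k, I = idxPair k := by
  revert I
  decide

/-- In lexicographic order of the six pairs, complementation reverses the list. -/
theorem dualIdx_idxPair (k : Fin 6) : dualIdx (idxPair k) = idxPair (5 - k) := by
  revert k
  decide

theorem minor_idxPair {A : Type*} [CommRing A] (M : Matrix (Fin 4) (Fin 4) A) (k l : Fin 6) :
    minor M (idxPair k) (idxPair l) = pairMinor M k l := by
  rw [minor, Matrix.det_fin_two]
  simp [idxPair, pairMinor]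

theorem epsilon_eq_sign {I J : IdxPair} (σ : Equiv.Perm (Fin 4))
    (h : ![I.1.1, I.1.2, J.1.1, J.1.2] = σ) : epsilon I J = Equiv.Perm.sign σ := by
  have hb : Function.Bijective ![I.1.1, I.1.2, J.1.1, J.1.2] := h ▸ σ.bijective
  rw [epsilon, dif_pos hb]
  congr 2
  ext i
  rw [Equiv.ofBijective_apply, h]

theorem epsilon_idxPair (k : Fin 6) :
    epsilon (idxPair k) (idxPair (5 - k)) = pairSign k := by
  fin_cases k
  · exact (epsilon_eq_sign 1 (by decide)).trans (by decide)
  · exact (epsilon_eq_sign (Equiv.swap 1 2) (by decide)).trans (by decide)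
  · exact (epsilon_eq_sign (Equiv.swap 1 2 * Equiv.swap 1 3) (by decide)).trans (by decide)
  · exact (epsilon_eq_sign (Equiv.swap 0 1 * Equiv.swap 1 2) (by decide)).trans (by decide)
  · exact (epsilon_eq_sign (Equiv.swap 0 1 * Equiv.swap 1 3 * Equiv.swap 3 2)
      (by decide)).trans (by decide)
  · exact (epsilon_eq_sign (Equiv.swap 0 2 * Equiv.swap 1 3) (by decide)).trans (by decide)

theorem intCast_pairSign {A : Type*} [CommRing A] (k : Fin 6) :
    ((pairSign k : ℤ) : A) = pairSign k := by
  fin_cases k <;> simp [pairSign]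

/-- The target is an arbitrary ring because two homomorphisms are needed: evaluation at a point, and
the quotient map by the ideal of the relations. -/
theorem spinRel_iff {A : Type*} [CommRing A] (f : MvPolynomial CoordIdx ℂ →+* A) :
    SpinRel (genV.map f) (genW.map f) ↔ ∀ q ∈ spinRelations, f q = 0 := by
  have hmul : ∀ i j, f ((genV * genW) i j) = (genV.map f * genW.map f) i j := by
    intro i j
    rw [← Matrix.map_mul, Matrix.map_apply]
  have hpm : ∀ M : Matrix (Fin 4) (Fin 4) (MvPolynomial CoordIdx ℂ), ∀ k l,
      f (pairMinor M k l) = pairMinor (M.map f) k l := by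
    intro M k l
    simp [pairMinor]
  have hminor : ∀ k l, f (minor genV (idxPair k) (idxPair l) -
      ((epsilon (idxPair k) (dualIdx (idxPair k)) * epsilon (idxPair l) (dualIdx (idxPair l)) : ℤ) :
        MvPolynomial CoordIdx ℂ) * minor genW (dualIdx (idxPair k)) (dualIdx (idxPair l))) =
      pairMinor (genV.map f) k l -
        pairSign k * pairSign l * pairMinor (genW.map f) (5 - k) (5 - l) := by
    intro k l
    rw [dualIdx_idxPair, dualIdx_idxPair, minor_idxPair, minor_idxPair, map_sub, hpm, map_mul,
      hpm, map_intCast, epsilon_idxPair, epsilon_idxPair, Int.cast_mul, intCast_pairSign,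
      intCast_pairSign]
  constructor
  · rintro h q ((⟨I, J, rfl⟩ | ⟨i, j, hij, rfl⟩) | ⟨i, j, hij, rfl⟩)
    · obtain ⟨k, rfl⟩ := exists_idxPair_eq I
      obtain ⟨l, rfl⟩ := exists_idxPair_eq J
      rw [hminor, h.minor k l, sub_self]
    · rw [hmul, h.offDiag i j hij]
    · rw [map_sub, hmul, hmul, h.diag i j hij, sub_self]
  · intro h
    refine ⟨fun k l => ?_, fun i j hij => ?_, fun i j hij => ?_⟩
    · rw [← sub_eq_zero, ← hminor]
      exact h _ (Or.inl (Or.inl ⟨_, _, rfl⟩))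
    · rw [← hmul]
      exact h _ (Or.inl (Or.inr ⟨i, j, hij, rfl⟩))
    · rw [← sub_eq_zero, ← hmul, ← hmul, ← map_sub]
      exact h _ (Or.inr ⟨i, j, hij, rfl⟩)

theorem genV_isSymm : genV.IsSymm := by
  ext i j : 2
  simp [genV, Sym2.eq_swap]

theorem genW_isSymm : genW.IsSymm := by
  ext i j : 2
  simp [genW, Sym2.eq_swap]

theorem map_genV_coords {v w : Matrix (Fin 4) (Fin 4) ℂ} (hv : v.IsSymm) :
    genV.map (MvPolynomial.aeval (coords v w)) = v := by
  ext i j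
  simp [genV, coords_inl v w hv]

theorem map_genW_coords {v w : Matrix (Fin 4) (Fin 4) ℂ} (hw : w.IsSymm) :
    genW.map (MvPolynomial.aeval (coords v w)) = w := by
  ext i j
  simp [genW, coords_inr v w hw]

theorem mem_zeroLocus_spinRelations_iff {v w : Matrix (Fin 4) (Fin 4) ℂ} (hv : v.IsSymm)
    (hw : w.IsSymm) :
    coords v w ∈ MvPolynomial.zeroLocus ℂ (Ideal.span spinRelations) ↔ SpinRel v w := by
  have h := spinRel_iff (MvPolynomial.aeval (R := ℂ) (coords v w)).toRingHom
  simp only [AlgHom.toRingHom_eq_coe, RingHom.coe_coe] at h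
  rw [map_genV_coords hv, map_genW_coords hw] at h
  rw [h, MvPolynomial.zeroLocus_span]
  rfl

/-! ### Consequences of the relations -/

section

variable {v w : Matrix (Fin 4) (Fin 4) ℂ}

theorem SpinRel.mul_eq (h : SpinRel v w) :
    v * w = ((v * w) 0 0) • (1 : Matrix (Fin 4) (Fin 4) ℂ) := by
  ext i j
  by_cases hij : i = j
  · subst hij
    by_cases hi : i = 0
    · simp [hi]
    · rw [h.diag i 0 hi]; simp
  · rw [h.offDiag i j hij]; simp [hij]

/-- Laplace expansion along the first two rows. -/
theorem det_eq_sum_pairMinor (M : Matrix (Fin 4) (Fin 4) ℂ) :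
    M.det = ∑ l, pairSign l * pairMinor M 0 l * pairMinor M 5 (5 - l) := by
  rw [Matrix.det_succ_row_zero]
  simp [Fin.sum_univ_succ, Matrix.det_fin_three, Fin.succAbove, pairSign, pairMinor, pairFst,
    pairSnd]
  ring

theorem SpinRel.det_eq (h : SpinRel v w) : v.det = w.det := by
  rw [det_eq_sum_pairMinor, det_eq_sum_pairMinor]
  simp only [h.minor]
  simp [Fin.sum_univ_succ, pairSign]
  ring

theorem pairMinor_mul (M N : Matrix (Fin 4) (Fin 4) ℂ) (k l : Fin 6) :
    pairMinor (M * N) k l = ∑ j, pairMinor M k j * pairMinor N j l := by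
  simp [Fin.sum_univ_succ, pairMinor, Matrix.mul_apply, pairFst, pairSnd]
  ring

/-- The first principal `2 × 2` minor of the scalar matrix `v * w` is the square of the scalar.
Cauchy–Binet expands it, and replacing the minors of `v` by complementary minors of `w` gives the
Laplace expansion of `det w`. -/
theorem SpinRel.sq_eq (h : SpinRel v w) (hw : w.IsSymm) : ((v * w) 0 0) ^ 2 = w.det := by
  have h1 : pairMinor (v * w) 0 0 = ((v * w) 0 0) ^ 2 := by
    have h2 := h.offDiag 0 1 (by decide)
    have h3 := h.diag 0 1 (by decide)
    simp [pairMinor, pairFst, pairSnd, h2, ← h3]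
    ring
  rw [← h1, pairMinor_mul, det_eq_sum_pairMinor]
  refine Finset.sum_congr rfl fun j _ => ?_
  rw [h.minor, pairMinor_comm hw j 0]
  simp [pairSign]
  ring

theorem rank_le_one_iff (M : Matrix (Fin 4) (Fin 4) ℂ) :
    M.rank ≤ 1 ↔ ∀ k l, pairMinor M k l = 0 := by
  constructor
  · intro h k l
    by_contra hne
    have hdet : (M.submatrix ![pairFst k, pairSnd k] ![pairFst l, pairSnd l]).det ≠ 0 := by
      rw [Matrix.det_fin_two]
      simpa [pairMinor] using hne
    have h2 := Matrix.rank_of_isUnit _ ((Matrix.isUnit_iff_isUnit_det _).mpr hdet.isUnit)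
    have h3 := Matrix.rank_submatrix_le M ![pairFst k, pairSnd k] ![pairFst l, pairSnd l]
    rw [h2, Fintype.card_fin] at h3
    omega
  · intro h
    -- Minors with repeated or decreasing indices are zero or differ by a sign from those indexed by
    -- increasing pairs.
    have hall : ∀ i j k l, M i k * M j l = M i l * M j k := by
      have hpair : ∀ i j : Fin 4, i = j ∨ ∃ k : Fin 6, (pairFst k = i ∧ pairSnd k = j) ∨
          (pairFst k = j ∧ pairSnd k = i) := by decide
      intro i j k l
      rcases hpair i j with rfl | ⟨r, ⟨rfl, rfl⟩ | ⟨rfl, rfl⟩⟩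
      · ring
      all_goals
        rcases hpair k l with rfl | ⟨s, ⟨rfl, rfl⟩ | ⟨rfl, rfl⟩⟩
        · ring
        all_goals
          have := h r s
          rw [pairMinor] at this
          first
          | linear_combination this
          | linear_combination -this
    by_cases hM : M = 0
    · simp [hM]
    obtain ⟨i, j, hij⟩ : ∃ i j, M i j ≠ 0 := by
      by_contra! hcon
      exact hM (Matrix.ext hcon)
    -- A nonzero entry `M i j` writes `M` as its `j`-th column, rescaled, times its `i`-th row.
    have hvec : M = Matrix.vecMulVec (fun a => M a j / M i j) (M i) := by
      ext a c
      rw [Matrix.vecMulVec_apply]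
      field_simp
      linear_combination hall i a j c
    rw [hvec]
    exact Matrix.rank_vecMulVec_le _ _

theorem SpinRel.rank_le_one_iff (h : SpinRel v w) : v.rank ≤ 1 ↔ w.rank ≤ 1 := by
  have hs : ∀ k, (pairSign k : ℂ) ≠ 0 := by
    intro k
    fin_cases k <;> simp [pairSign]
  rw [DoubleSpin.rank_le_one_iff, DoubleSpin.rank_le_one_iff]
  constructor
  · intro h1 k l
    have h2 := h.minor (5 - k) (5 - l)
    rw [h1, sub_sub_cancel, sub_sub_cancel] at h2
    simpa [hs] using h2.symm
  · intro h1 k l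
    rw [h.minor, h1, mul_zero]

theorem SpinRel.rank_add_rank_le (h : SpinRel v w) (hdet : w.det = 0) (hw : w.IsSymm) :
    v.rank + w.rank ≤ 4 := by
  have h0 : (v * w) 0 0 = 0 := by
    have := h.sq_eq hw
    rw [hdet] at this
    exact pow_eq_zero_iff (two_ne_zero) |>.mp this
  have hz : v * w = 0 := by rw [h.mul_eq, h0, zero_smul]
  simpa using Matrix.rank_add_rank_le_card_of_mul_eq_zero hz

theorem SpinRel.consequences (h : SpinRel v w) (hw : w.IsSymm) :
    v.det = w.det ∧
      (∃ c : ℂ, c ^ 2 = w.det ∧ v * w = c • (1 : Matrix (Fin 4) (Fin 4) ℂ)) ∧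
      (v.rank ≠ 3 ∧ w.rank ≠ 3) ∧ (v.rank = 2 ↔ w.rank = 2) ∧ (v.rank ≤ 1 ↔ w.rank ≤ 1) := by
  refine ⟨h.det_eq, ⟨_, h.sq_eq hw, h.mul_eq⟩, ?_⟩
  have h1 := h.rank_le_one_iff
  -- If the determinant vanishes, the rank sum is at most 4, so rank 3 of one matrix would force
  -- rank at most 1 of both, and rank 2 of one forces rank 2 of the other. Otherwise both ranks are
  -- 4.
  by_cases hdet : w.det = 0
  · have h2 := h.rank_add_rank_le hdet hw
    omega
  · have h3 := Matrix.rank_of_det_ne_zero hdet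
    have h4 := Matrix.rank_of_det_ne_zero (h.det_eq ▸ hdet)
    rw [Fintype.card_fin] at h3 h4
    omega

end

/-! ### Standard monomials span -/

/-- A monomial in the Plücker coordinates is standard if its support is a chain. -/
def IsStandard (m : Fin 20 →₀ ℕ) : Prop :=
  ∀ s ∈ m.support, ∀ t ∈ m.support, tri s ≤ tri t ∨ tri t ≤ tri s

/-- A weight that straightening decreases. -/
def triWeight (t : Fin 20) : ℕ := 144 - (∑ i, (tri t i : ℕ)) ^ 2

theorem exists_mem_straightening (s t : Fin 20) (h : ¬(tri s ≤ tri t ∨ tri t ≤ tri s)) :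
    ∃ e ∈ straightening, (e.1 = s ∧ e.2.1 = t) ∨ (e.1 = t ∧ e.2.1 = s) := by
  have key : ∀ s t : Fin 20, ¬((∀ i, tri s i ≤ tri t i) ∨ (∀ i, tri t i ≤ tri s i)) →
      ∃ e ∈ straightening, (e.1 = s ∧ e.2.1 = t) ∨ (e.1 = t ∧ e.2.1 = s) := by decide +kernel
  exact key s t h

/-- Straightening keeps the total of the six indices but spreads the two index sums farther apart,
so the sum of their squares grows. Here 144 is the square of the largest index sum, 3 + 4 + 5, so
the truncated subtraction in `triWeight` is exact. -/
theorem triWeight_lt : ∀ e ∈ straightening, ∀ r ∈ e.2.2,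
    triWeight r.2.1 + triWeight r.2.2 < triWeight e.1 + triWeight e.2.1 := by decide +kernel

/-- The span of the standard monomials. -/
def standardSpan : Submodule ℂ (MvPolynomial (Fin 20) ℂ) :=
  Submodule.span ℂ ((fun m => MvPolynomial.monomial m 1) '' {m | IsStandard m})

section

variable {A : Type*} [CommRing A] [Algebra ℂ A] {P : Fin 20 → A}

/-- A nonstandard monomial contains two incomparable factors; the straightening relation for them
rewrites it into monomials of smaller total weight, so the induction terminates. -/
theorem aeval_monomial_mem_standardSpan (hP : IsStraight P) (m : Fin 20 →₀ ℕ) :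
    MvPolynomial.aeval P (MvPolynomial.monomial m (1 : ℂ)) ∈
      standardSpan.map (MvPolynomial.aeval P).toLinearMap := by
  induction h : Finsupp.weight triWeight m using Nat.strong_induction_on generalizing m with
  | _ n ih =>
  subst h
  by_cases hm : IsStandard m
  · exact Submodule.mem_map_of_mem (Submodule.subset_span ⟨m, hm, rfl⟩)
  · simp only [IsStandard, not_forall] at hm
    obtain ⟨s, hs, t, ht, hst⟩ := hm
    obtain ⟨e, he, hest⟩ := exists_mem_straightening s t hst
    -- Distinctness guarantees that the product of the two variables divides the monomial.
    have hne : s ≠ t := by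
      rintro rfl
      exact hst (Or.inl le_rfl)
    have hle : Finsupp.single e.1 1 + Finsupp.single e.2.1 1 ≤ m := by
      have h1 : Finsupp.single s 1 + Finsupp.single t 1 ≤ m := by
        intro r
        rw [Finsupp.mem_support_iff] at hs ht
        rw [Finsupp.add_apply, Finsupp.single_apply, Finsupp.single_apply]
        split_ifs with h1 h2 h2
        · exact absurd (h1.trans h2.symm) hne
        · subst h1; omega
        · subst h2; omega
        · omega
      rcases hest with ⟨rfl, rfl⟩ | ⟨rfl, rfl⟩
      · exact h1
      · rwa [add_comm]
    obtain ⟨m', rfl⟩ := exists_add_of_le hle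
    have hmon : ∀ x y, MvPolynomial.aeval P (MvPolynomial.monomial
        (Finsupp.single x 1 + Finsupp.single y 1 + m') (1 : ℂ)) =
        P x * P y * MvPolynomial.aeval P (MvPolynomial.monomial m' (1 : ℂ)) := by
      intro x y
      rw [← one_mul (1 : ℂ), ← MvPolynomial.monomial_mul, ← one_mul (1 : ℂ),
        ← MvPolynomial.monomial_mul, map_mul, map_mul]
      simp [MvPolynomial.aeval_monomial]
    rw [hmon, hP e he, ← List.sum_map_mul_right]
    refine list_sum_mem fun x hx => ?_
    obtain ⟨r, hr, rfl⟩ := List.mem_map.mp hx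
    rw [mul_assoc, mul_assoc, ← mul_assoc (P r.2.1), ← hmon, ← zsmul_eq_mul]
    refine zsmul_mem (ih _ ?_ _ rfl) _
    have hlt := triWeight_lt e he r hr
    simp only [map_add, Finsupp.weight_single, smul_eq_mul, one_mul]
    omega

theorem exists_mem_standardSpan_aeval_eq (hP : IsStraight P) (F : MvPolynomial (Fin 20) ℂ) :
    ∃ S ∈ standardSpan, MvPolynomial.aeval P F = MvPolynomial.aeval P S := by
  have h : MvPolynomial.aeval P F ∈ standardSpan.map (MvPolynomial.aeval P).toLinearMap := by
    rw [F.as_sum, map_sum]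
    refine Submodule.sum_mem _ fun m _ => ?_
    have h1 : MvPolynomial.monomial m (F.coeff m) =
        F.coeff m • MvPolynomial.monomial m (1 : ℂ) := by
      rw [MvPolynomial.smul_monomial, smul_eq_mul, mul_one]
    rw [h1, map_smul]
    exact Submodule.smul_mem _ _ (aeval_monomial_mem_standardSpan hP m)
  obtain ⟨S, hS, hFS⟩ := h
  exact ⟨S, hS, hFS.symm⟩

end

/-! ### Standard monomials in the minors of a generic matrix are linearly independent -/

/-- The exponent of the monomial `∏ x_{i, f i}`. -/
def diagExp (f : Fin 3 → Fin 6) : (Fin 3 ×ₗ Fin 6) →₀ ℕ :=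
  ∑ i, Finsupp.single (toLex (i, f i)) 1

theorem diagExp_apply (f : Fin 3 → Fin 6) (i : Fin 3) (j : Fin 6) :
    diagExp f (toLex (i, j)) = if f i = j then 1 else 0 := by
  simp only [diagExp, Finsupp.finsetSum_apply, Finsupp.single_apply, EmbeddingLike.apply_eq_iff_eq,
    Prod.mk.injEq]
  rw [Finset.sum_eq_single i]
  · simp
  · intro k _ hk; simp [hk]
  · simp

/-- In this lexicographic order earlier rows count first and, within a row, variables in earlier
columns are larger. -/
theorem diagExp_lt {f g : Fin 3 → Fin 6} (i : Fin 3) (h : ∀ k < i, f k = g k) (hi : g i < f i) :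
    MonomialOrder.lex.toSyn (diagExp f) < MonomialOrder.lex.toSyn (diagExp g) := by
  rw [MonomialOrder.lex_lt_iff, Finsupp.Lex.lt_iff]
  refine ⟨toLex (i, g i), fun x hx => ?_, ?_⟩
  · obtain ⟨⟨k, j⟩, rfl⟩ := toLex.surjective x
    change diagExp f (toLex (k, j)) = diagExp g (toLex (k, j))
    rw [diagExp_apply, diagExp_apply]
    rw [Prod.Lex.toLex_lt_toLex] at hx
    rcases hx with hx | ⟨hx, hx'⟩
    · rw [h k hx]
    · simp only at hx hx'
      subst hx
      rw [if_neg (hx'.trans hi).ne', if_neg hx'.ne']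
  · change diagExp f (toLex (i, g i)) < diagExp g (toLex (i, g i))
    rw [diagExp_apply, diagExp_apply, if_neg hi.ne', if_pos rfl]
    exact one_pos

/-- The generic `3 × 6` matrix. -/
def genMatrix : Matrix (Fin 3) (Fin 6) (MvPolynomial (Fin 3 ×ₗ Fin 6) ℂ) :=
  Matrix.of fun i j => MvPolynomial.X (toLex (i, j))

theorem tri_strictMono (t : Fin 20) : StrictMono (tri t) := by
  have key : ∀ t : Fin 20, ∀ i j, i < j → tri t i < tri t j := by decide
  exact fun i j => key t i j

theorem prod_genMatrix (f : Fin 3 → Fin 6) :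
    ∏ i, genMatrix i (f i) = MvPolynomial.monomial (diagExp f) 1 := by
  rw [diagExp, MvPolynomial.monomial_sum_one]
  rfl

theorem maxMinors_genMatrix (t : Fin 20) :
    maxMinors genMatrix t = MvPolynomial.monomial (diagExp (tri t)) 1 +
      ∑ σ ∈ Finset.univ.erase (1 : Equiv.Perm (Fin 3)),
        MvPolynomial.monomial (diagExp (tri t ∘ σ)) ((Equiv.Perm.sign σ : ℤ) : ℂ) := by
  rw [maxMinors, ← Matrix.det_transpose, Matrix.det_apply,
    ← Finset.add_sum_erase _ _ (Finset.mem_univ (1 : Equiv.Perm (Fin 3)))]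
  congr 1
  · rw [Equiv.Perm.sign_one, one_smul, ← prod_genMatrix]
    rfl
  · refine Finset.sum_congr rfl fun σ _ => ?_
    have : ∏ i, (genMatrix.submatrix id (tri t))ᵀ (σ i) i =
        MvPolynomial.monomial (diagExp (tri t ∘ σ)) 1 := by
      rw [← prod_genMatrix]
      rfl
    rw [this, Units.smul_def, ← Int.cast_smul_eq_zsmul ℂ, MvPolynomial.smul_monomial, smul_eq_mul,
      mul_one]

theorem degree_maxMinors_genMatrix (t : Fin 20) :
    MonomialOrder.lex.degree (maxMinors genMatrix t) = diagExp (tri t) := by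
  -- The first index moved by a permutation moves up, so the diagonal term of a minor with
  -- increasing columns leads all other terms.
  have key : ∀ σ : Equiv.Perm (Fin 3), σ ≠ 1 → ∃ i, (∀ k < i, σ k = k) ∧ i < σ i := by decide
  have hd : MonomialOrder.lex.degree (MvPolynomial.monomial (diagExp (tri t)) (1 : ℂ)) =
      diagExp (tri t) := by
    classical
    rw [MonomialOrder.degree_monomial, if_neg one_ne_zero]
  have hlt : ∀ σ ∈ Finset.univ.erase (1 : Equiv.Perm (Fin 3)),
      MonomialOrder.lex.toSyn (diagExp (tri t ∘ σ)) <
        MonomialOrder.lex.toSyn (diagExp (tri t)) := by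
    intro σ hσ
    obtain ⟨i, h1, h2⟩ := key σ (Finset.ne_of_mem_erase hσ)
    exact diagExp_lt i (fun k hk => by simp [h1 k hk]) (tri_strictMono t h2)
  rw [maxMinors_genMatrix, MonomialOrder.degree_add_of_lt, hd]
  rw [hd]
  refine lt_of_le_of_lt MonomialOrder.degree_sum_le ((Finset.sup_lt_iff ?_).mpr fun σ hσ =>
    lt_of_le_of_lt (MonomialOrder.degree_monomial_le _) (hlt σ hσ))
  -- `Finset.sup_lt_iff` also requires the bound to exceed `⊥`; a transposition supplies this.
  exact lt_of_le_of_lt bot_le (hlt (Equiv.swap 0 1) (by decide))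

theorem maxMinors_genMatrix_ne_zero (t : Fin 20) : maxMinors genMatrix t ≠ 0 := by
  refine MonomialOrder.ne_zero_of_degree_ne_zero (m := MonomialOrder.lex) ?_
  rw [degree_maxMinors_genMatrix]
  intro h
  have := DFunLike.congr_fun h (toLex (0, tri t 0))
  rw [diagExp_apply, if_pos rfl] at this
  exact one_ne_zero this

/-- The leading exponent of a monomial in the minors of a generic matrix. -/
def leadExp : (Fin 20 →₀ ℕ) →+ ((Fin 3 ×ₗ Fin 6) →₀ ℕ) :=
  Finsupp.weight fun t => diagExp (tri t)

theorem degree_aeval_monomial (m : Fin 20 →₀ ℕ) :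
    MonomialOrder.lex.degree (MvPolynomial.aeval (maxMinors genMatrix)
      (MvPolynomial.monomial m (1 : ℂ))) = leadExp m ∧
    MvPolynomial.aeval (maxMinors genMatrix) (MvPolynomial.monomial m (1 : ℂ)) ≠ 0 := by
  rw [MvPolynomial.aeval_monomial, map_one, one_mul, Finsupp.prod]
  constructor
  · rw [MonomialOrder.degree_prod fun t _ => pow_ne_zero _ (maxMinors_genMatrix_ne_zero t)]
    simp only [MonomialOrder.degree_pow, degree_maxMinors_genMatrix]
    rfl
  · exact Finset.prod_ne_zero_iff.mpr fun t _ => pow_ne_zero _ (maxMinors_genMatrix_ne_zero t)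

theorem leadExp_apply (m : Fin 20 →₀ ℕ) (i : Fin 3) (j : Fin 6) :
    leadExp m (toLex (i, j)) = ∑ t ∈ m.support, if tri t i = j then m t else 0 := by
  simp only [leadExp, Finsupp.weight_apply, Finsupp.sum, Finsupp.finsetSum_apply,
    Finsupp.smul_apply, diagExp_apply, smul_eq_mul, mul_ite, mul_one, mul_zero]

theorem leadExp_apply_ne_zero_iff (m : Fin 20 →₀ ℕ) (i : Fin 3) (j : Fin 6) :
    leadExp m (toLex (i, j)) ≠ 0 ↔ ∃ t ∈ m.support, tri t i = j := by
  rw [leadExp_apply, ne_eq, Finset.sum_eq_zero_iff]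
  simp only [ite_eq_right_iff, not_forall, Finsupp.mem_support_iff, exists_prop]
  constructor
  · rintro ⟨t, ht, h, -⟩; exact ⟨t, ht, h⟩
  · rintro ⟨t, ht, h⟩; exact ⟨t, ht, h, ht⟩

theorem tri_injective : Function.Injective tri := by
  have key : ∀ s t : Fin 20, (∀ i, tri s i = tri t i) → s = t := by decide +kernel
  exact fun s t h => key s t fun i => congrFun h i

theorem IsStandard.exists_min {m : Fin 20 →₀ ℕ} (hm : IsStandard m) (h0 : m ≠ 0) :
    ∃ s ∈ m.support, ∀ t ∈ m.support, tri s ≤ tri t := by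
  -- The lexicographic numbering of triples extends the componentwise order, so the smallest number
  -- in a chain is its least triple.
  have key : ∀ s t : Fin 20, s ≤ t → (∀ i, tri t i ≤ tri s i) → ∀ i, tri s i ≤ tri t i := by
    decide +kernel
  have hne : m.support.Nonempty := Finsupp.support_nonempty_iff.mpr h0
  refine ⟨m.support.min' hne, m.support.min'_mem hne, fun t ht => ?_⟩
  rcases hm _ (m.support.min'_mem hne) t ht with h | h
  · exact h
  · exact key _ t (m.support.min'_le t ht) h

theorem IsStandard.of_add {m n : Fin 20 →₀ ℕ} (h : IsStandard (m + n)) : IsStandard n := by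
  have hsub : ∀ s ∈ n.support, s ∈ (m + n).support := by
    intro s hs
    rw [Finsupp.mem_support_iff] at hs ⊢
    rw [Finsupp.add_apply]
    omega
  exact fun s hs t ht => h s (hsub s hs) t (hsub t ht)

/-- The columns occurring in row `i` of the leading exponent are the `i`-th entries of the triples
in the support. Their minima over the rows give the least triple of the chain; removing it from both
monomials allows induction on the degree. -/
theorem leadExp_injOn {m n : Fin 20 →₀ ℕ} (hm : IsStandard m) (hn : IsStandard n)
    (h : leadExp m = leadExp n) : m = n := by
  induction hd : m.degree generalizing m n with
  | zero =>
    rw [Finsupp.degree_eq_zero_iff] at hd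
    subst hd
    by_contra hne
    obtain ⟨t, ht⟩ := Finsupp.support_nonempty_iff.mpr (Ne.symm hne)
    have := (leadExp_apply_ne_zero_iff n 0 (tri t 0)).mpr ⟨t, ht, rfl⟩
    rw [← h, map_zero] at this
    exact this rfl
  | succ d ih =>
    have hle : ∀ {m n : Fin 20 →₀ ℕ} {s t : Fin 20}, leadExp m = leadExp n → s ∈ m.support →
        (∀ t' ∈ n.support, tri t ≤ tri t') → tri t ≤ tri s := by
      intro m n s t h hs ht i
      have h1 := (leadExp_apply_ne_zero_iff m i (tri s i)).mpr ⟨s, hs, rfl⟩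
      rw [h, leadExp_apply_ne_zero_iff] at h1
      obtain ⟨t', ht', h2⟩ := h1
      exact h2 ▸ ht t' ht' i
    have hm0 : m ≠ 0 := by
      rintro rfl
      simp at hd
    have hn0 : n ≠ 0 := by
      rintro rfl
      obtain ⟨t, ht⟩ := Finsupp.support_nonempty_iff.mpr hm0
      have := (leadExp_apply_ne_zero_iff m 0 (tri t 0)).mpr ⟨t, ht, rfl⟩
      rw [h, map_zero] at this
      exact this rfl
    obtain ⟨s, hs, hs'⟩ := hm.exists_min hm0
    obtain ⟨t, ht, ht'⟩ := hn.exists_min hn0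
    obtain rfl : s = t := tri_injective (le_antisymm (hle h.symm ht hs') (hle h hs ht'))
    have hsingle : ∀ {m : Fin 20 →₀ ℕ}, s ∈ m.support → ∃ m', m = Finsupp.single s 1 + m' := by
      intro m hs
      refine exists_add_of_le (Finsupp.single_le_iff.mpr ?_)
      rw [Finsupp.mem_support_iff] at hs
      omega
    obtain ⟨m', rfl⟩ := hsingle hs
    obtain ⟨n', rfl⟩ := hsingle ht
    rw [map_add, map_add] at h
    rw [ih hm.of_add hn.of_add (add_left_cancel h)]
    rw [map_add, Finsupp.degree_single] at hd
    omega

theorem eq_zero_of_aeval_maxMinors_genMatrix_eq_zero {S : MvPolynomial (Fin 20) ℂ}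
    (hS : S ∈ standardSpan)
    (h : MvPolynomial.aeval (maxMinors genMatrix) S = 0) : S = 0 := by
  have hstd : ∀ m ∈ S.support, IsStandard m := by
    clear h
    induction hS using Submodule.span_induction with
    | mem x hx =>
      obtain ⟨n, hn, rfl⟩ := hx
      intro m hm
      rw [Finset.mem_singleton.mp (MvPolynomial.support_monomial_subset hm)]
      exact hn
    | zero => simp
    | add x y _ _ hx hy =>
      intro m hm
      exact (Finset.mem_union.mp (MvPolynomial.support_add hm)).elim (hx m) (hy m)
    | smul c x _ hx => exact fun m hm => hx m (MvPolynomial.support_smul hm)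
  by_contra hne
  -- The monomial with the largest leading exponent cannot be cancelled, since standard monomials
  -- have distinct leading exponents.
  obtain ⟨m, hm, hmax⟩ := S.support.exists_max_image
    (fun m => MonomialOrder.lex.toSyn (leadExp m)) (MvPolynomial.support_nonempty.mpr hne)
  have h1 : (MvPolynomial.aeval (maxMinors genMatrix) S).coeff (leadExp m) =
      S.coeff m * (MvPolynomial.aeval (maxMinors genMatrix)
        (MvPolynomial.monomial m (1 : ℂ))).coeff (leadExp m) := by
    conv_lhs => rw [S.as_sum, map_sum, MvPolynomial.coeff_sum]
    have hsm : ∀ n, MvPolynomial.monomial n (S.coeff n) =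
        S.coeff n • MvPolynomial.monomial n (1 : ℂ) := by
      intro n
      rw [MvPolynomial.smul_monomial, smul_eq_mul, mul_one]
    simp only [hsm, map_smul, MvPolynomial.coeff_smul, smul_eq_mul]
    refine Finset.sum_eq_single_of_mem m hm fun n hn hnm => ?_
    have hlt : MonomialOrder.lex.toSyn (MonomialOrder.lex.degree
        (MvPolynomial.aeval (maxMinors genMatrix) (MvPolynomial.monomial n (1 : ℂ)))) <
        MonomialOrder.lex.toSyn (leadExp m) := by
      rw [(degree_aeval_monomial n).1]
      refine lt_of_le_of_ne (hmax n hn) fun heq => hnm ?_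
      exact leadExp_injOn (hstd n hn) (hstd m hm) (MonomialOrder.lex.toSyn.injective heq)
    rw [MonomialOrder.coeff_eq_zero_of_lt hlt, mul_zero]
  rw [h, MvPolynomial.coeff_zero] at h1
  have h2 := (degree_aeval_monomial m).2
  rw [← MonomialOrder.coeff_degree_ne_zero_iff (m := MonomialOrder.lex),
    (degree_aeval_monomial m).1] at h2
  exact mul_ne_zero (MvPolynomial.mem_support_iff.mp hm) h2 h1.symm

/-! ### Decomposable trivectors -/

section

variable {K M : Type*} [Field K] [AddCommGroup M] [Module K M]

/-- It suffices to compare on injective families of basis vectors, which are permutations of `e`. -/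
theorem alternatingMap_eq_det_smul {N ι : Type*} [AddCommGroup N] [Module K N] [Fintype ι]
    [DecidableEq ι] (e : Module.Basis ι K M) (f : M [⋀^ι]→ₗ[K] N) (u : ι → M) :
    f u = e.det u • f e := by
  have h : f = (LinearMap.toSpanSingleton K N (f e)).compAlternatingMap e.det := by
    refine Module.Basis.ext_alternating e fun i hi => ?_
    let σ := Equiv.ofBijective i (Finite.injective_iff_bijective.mp hi)
    change f (e ∘ σ) = (LinearMap.toSpanSingleton K N (f e)).compAlternatingMap e.det (e ∘ σ)
    rw [AlternatingMap.map_perm, AlternatingMap.map_perm, LinearMap.compAlternatingMap_apply,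
      LinearMap.toSpanSingleton_apply, e.det_self, one_smul]
  conv_lhs => rw [h]
  rfl

/-- The line `⋀ⁿU ⊆ ⋀ⁿM` of an `n`-dimensional subspace `U`. -/
def exteriorLine (n : ℕ) (U : Submodule K M) : Submodule K (⋀[K]^n M) :=
  Submodule.span K (Set.range fun u : Fin n → U => exteriorPower.ιMulti K n fun i => (u i : M))

theorem exists_eq_smul_of_mem_exteriorLine {n : ℕ} [NeZero n] {U : Submodule K M}
    (hU : Module.finrank K U = n) {ω : ⋀[K]^n M} (hω : ω ∈ exteriorLine n U) :
    ∃ (c : K) (u : Fin n → M), ω = c • exteriorPower.ιMulti K n u := by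
  have : Module.Finite K U := Module.finite_of_finrank_pos (hU ▸ NeZero.pos n)
  let e := Module.finBasisOfFinrankEq K U hU
  suffices h : ω ∈ Submodule.span K {exteriorPower.ιMulti K n fun i => (e i : M)} by
    obtain ⟨c, rfl⟩ := Submodule.mem_span_singleton.mp h
    exact ⟨c, _, rfl⟩
  refine (Submodule.span_le.mpr ?_) hω
  rintro _ ⟨u, rfl⟩
  refine Submodule.mem_span_singleton.mpr ⟨e.det u, ?_⟩
  exact (alternatingMap_eq_det_smul e ((exteriorPower.ιMulti K n).compLinearMap U.subtype) u).symm

/-- If some `x` in `U'` is outside `U`, a linear map fixing `U` pointwise and killing `x` fixes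
`⋀ⁿU`, but kills `⋀ⁿU'` because the image of `U'` has dimension less than `n`. So `ω` would be zero.
-/
theorem eq_of_mem_exteriorLine {n : ℕ} [NeZero n] {U U' : Submodule K M}
    (hU : Module.finrank K U = n) (hU' : Module.finrank K U' = n)
    {ω : ⋀[K]^n M} (h0 : ω ≠ 0) (h : ω ∈ exteriorLine n U) (h' : ω ∈ exteriorLine n U') :
    U = U' := by
  have : Module.Finite K U' := Module.finite_of_finrank_pos (hU' ▸ NeZero.pos n)
  by_contra hne
  obtain ⟨x, hx', hx⟩ : ∃ x ∈ U', x ∉ U := by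
    by_contra! hle
    have : Module.Finite K U := Module.finite_of_finrank_pos (hU ▸ NeZero.pos n)
    exact hne (Submodule.eq_of_le_of_finrank_eq hle (by rw [hU, hU'])).symm
  obtain ⟨π, hπU, hπx⟩ : ∃ π : M →ₗ[K] M, (∀ y ∈ U, π y = y) ∧ π x = 0 := by
    obtain ⟨f, hfx, hfU⟩ := Submodule.exists_le_ker_of_notMem hx
    -- Subtract the projection onto the line of `x` given by a functional `f` that vanishes on `U`
    -- but not at `x`.
    refine ⟨LinearMap.id - (LinearMap.toSpanSingleton K _ ((f x)⁻¹ • x)) ∘ₗ f, fun y hy => ?_, ?_⟩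
    · have : f y = 0 := hfU hy
      simp [this]
    · simp [smul_smul, mul_inv_cancel₀ hfx]
  have h1 : exteriorPower.map n π ω = ω := by
    have hle : exteriorLine n U ≤ LinearMap.eqLocus (exteriorPower.map n π) LinearMap.id := by
      refine Submodule.span_le.mpr ?_
      rintro _ ⟨u, rfl⟩
      change exteriorPower.map n π _ = _
      rw [exteriorPower.map_apply_ιMulti, LinearMap.id_apply]
      congr 1
      ext i
      exact hπU _ (u i).2
    exact hle h
  have h2 : exteriorPower.map n π ω = 0 := by
    have hle : exteriorLine n U' ≤ LinearMap.ker (exteriorPower.map n π) := by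
      refine Submodule.span_le.mpr ?_
      rintro _ ⟨u, rfl⟩
      change exteriorPower.map n π _ = 0
      rw [exteriorPower.map_apply_ιMulti]
      refine AlternatingMap.map_linearDependent _ _ fun hli => ?_
      have hli' : LinearIndependent K ((π ∘ₗ U'.subtype) ∘ u) := hli
      have hspan : (LinearMap.range (π ∘ₗ U'.subtype)) ≥
          Submodule.span K (Set.range ((π ∘ₗ U'.subtype) ∘ u)) := by
        refine Submodule.span_le.mpr ?_
        rintro _ ⟨i, rfl⟩
        exact ⟨u i, rfl⟩
      have hfin := Submodule.finrank_mono hspan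
      rw [finrank_span_eq_card hli', Fintype.card_fin] at hfin
      have hker := LinearMap.finrank_range_add_finrank_ker (π ∘ₗ U'.subtype)
      rw [hU'] at hker
      have hpos : 0 < Module.finrank K (LinearMap.ker (π ∘ₗ U'.subtype)) := by
        refine Module.finrank_pos_iff_exists_ne_zero.mpr ⟨⟨⟨x, hx'⟩, hπx⟩, fun hz => hx ?_⟩
        have : x = 0 := congrArg (fun y : LinearMap.ker (π ∘ₗ U'.subtype) => (y : U').1) hz
        rw [this]
        exact U.zero_mem
      omega
    exact hle h'
  exact h0 (h1.symm.trans h2)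

end

/-! ### Decomposable trivectors and the cone over the Grassmannian. -/

section

variable {V : Type*} [AddCommGroup V] [Module ℂ V]

theorem exists_mem_pluckerLine (b : Module.Basis (Fin 4) ℂ V) (c : ℂ) (u : Fin 3 → ⋀[ℂ]^2 V) :
    ∃ U : Submodule ℂ (⋀[ℂ]^2 V), Module.finrank ℂ U = 3 ∧
      c • exteriorPower.ιMulti ℂ 3 u ∈ pluckerLine U := by
  by_cases hu : LinearIndependent ℂ u
  · refine ⟨Submodule.span ℂ (Set.range u), by simpa using finrank_span_eq_card hu, ?_⟩
    refine Submodule.smul_mem _ c (Submodule.subset_span ?_)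
    exact ⟨fun i => ⟨u i, Submodule.subset_span ⟨i, rfl⟩⟩, rfl⟩
  · rw [AlternatingMap.map_linearDependent _ u hu, smul_zero]
    -- The trivector is zero here, so any three-dimensional subspace serves.
    refine ⟨Submodule.span ℂ (Set.range (bivectorBasis b ∘ tri 0)), ?_, Submodule.zero_mem _⟩
    have := (bivectorBasis b).linearIndependent.comp (tri 0) (tri_strictMono 0).injective
    simpa using finrank_span_eq_card this

variable (b : Module.Basis (Fin 4) ℂ V)

theorem mem_grassmannianCone_iff {a : CoordIdx → ℂ} :
    a ∈ grassmannianCone b ↔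
      ∃ (c : ℂ) (u : Fin 3 → ⋀[ℂ]^2 V), a = spinCoords b (c • exteriorPower.ιMulti ℂ 3 u) := by
  constructor
  · rintro ⟨U, hU, ω, hω, rfl⟩
    obtain ⟨c, u, rfl⟩ := exists_eq_smul_of_mem_exteriorLine hU hω
    exact ⟨c, u, rfl⟩
  · rintro ⟨c, u, rfl⟩
    obtain ⟨U, hU, h⟩ := exists_mem_pluckerLine b c u
    exact ⟨U, hU, _, h, rfl⟩

theorem spinRel_ιMulti (c : ℂ) (u : Fin 3 → ⋀[ℂ]^2 V) :
    SpinRel (spinV b (c • exteriorPower.ιMulti ℂ 3 u))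
      (spinW b (c • exteriorPower.ιMulti ℂ 3 u)) := by
  have h := (isStraight_maxMinors (coordMatrix b u)).spinRel
  rw [map_smul, map_smul, spinV_ιMulti_eq_vMat, spinW_ιMulti_eq_wMat]
  have hpm : ∀ (M : Matrix (Fin 4) (Fin 4) ℂ) k l,
      pairMinor (c • M) k l = c ^ 2 * pairMinor M k l := by
    intro M k l
    simp only [pairMinor, Matrix.smul_apply, smul_eq_mul]
    ring
  refine ⟨fun k l => ?_, fun i j hij => ?_, fun i j hij => ?_⟩
  · rw [hpm, hpm, h.minor k l]
    ring
  · rw [Matrix.smul_mul, Matrix.mul_smul, Matrix.smul_apply, Matrix.smul_apply, h.offDiag i j hij]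
    simp
  · simp only [Matrix.smul_mul, Matrix.mul_smul, Matrix.smul_apply, h.diag i j hij]

/-! ### The Plücker ideal -/

theorem span_spinRelations_le_pluckerIdeal : Ideal.span spinRelations ≤ pluckerIdeal b := by
  refine MvPolynomial.le_zeroLocus_iff_le_vanishingIdeal.mp fun a ha => ?_
  obtain ⟨c, u, rfl⟩ := (mem_grassmannianCone_iff b).mp ha
  exact (mem_zeroLocus_spinRelations_iff (spinV_isSymm b _) (spinW_isSymm b _)).mpr
    (spinRel_ιMulti b c u)

/-- A triple of bivectors with given coordinate matrix. -/
def bivectorTriple (M : Matrix (Fin 3) (Fin 6) ℂ) (i : Fin 3) : ⋀[ℂ]^2 V :=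
  (bivectorBasis b).equivFun.symm (M i)

theorem coordMatrix_bivectorTriple (M : Matrix (Fin 3) (Fin 6) ℂ) :
    coordMatrix b (bivectorTriple b M) = M := by
  ext i j
  exact congrFun ((bivectorBasis b).equivFun.apply_symm_apply (M i)) j

theorem plucker_map {A B : Type*} [CommRing A] [CommRing B] {F : Type*} [FunLike F A B]
    [RingHomClass F A B] (f : F) (v w : Matrix (Fin 4) (Fin 4) A) (t : Fin 20) :
    f (plucker v w t) = plucker (v.map f) (w.map f) t := by
  fin_cases t <;> simp [plucker]

theorem aeval_plucker_genV_genW (ω : ⋀[ℂ]^3 (⋀[ℂ]^2 V)) (S : MvPolynomial (Fin 20) ℂ) :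
    MvPolynomial.aeval (spinCoords b ω) (MvPolynomial.aeval (plucker genV genW) S) =
      MvPolynomial.aeval (fun t => 6 * pluckerCoord b (tri t) ω) S := by
  rw [MvPolynomial.comp_aeval_apply, ← plucker_spin]
  congr 2
  ext t
  rw [plucker_map, spinCoords, LinearMap.coe_mk, AddHom.coe_mk, map_genV_coords (spinV_isSymm b ω),
    map_genW_coords (spinW_isSymm b ω)]

theorem aeval_plucker_surjective :
    Function.Surjective (MvPolynomial.aeval (R := ℂ) (plucker genV genW)) := by
  rw [← AlgHom.range_eq_top, eq_top_iff, ← MvPolynomial.adjoin_range_X, Algebra.adjoin_le_iff]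
  set B := (MvPolynomial.aeval (R := ℂ) (plucker genV genW)).range
  -- With coordinates taken in the subalgebra `B`, the entries of `vMat p` and `wMat p` lie in `B`
  -- automatically.
  let p : Fin 20 → B := fun t => ⟨plucker genV genW t, MvPolynomial.X t, by simp⟩
  have hsmul : ∀ x : MvPolynomial CoordIdx ℂ, 6 * x ∈ B → x ∈ B := by
    intro x hx
    have h := B.smul_mem hx (1 / 6 : ℂ)
    rwa [← smul_eq_mul, show (6 : MvPolynomial CoordIdx ℂ) • x = (6 : ℂ) • x by
      rw [MvPolynomial.smul_eq_C_mul]; rfl, smul_smul, one_div,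
      inv_mul_cancel₀ (by norm_num), one_smul] at h
  have hV : ∀ i j, 6 * genV i j = vMat p i j := by
    intro i j
    have := congrFun (congrFun (vMat_plucker (w := genW) genV_isSymm) i) j
    rw [← smul_eq_mul, ← Matrix.smul_apply, ← this]
    fin_cases i <;> fin_cases j <;> rfl
  have hW : ∀ i j, 6 * genW i j = wMat p i j := by
    intro i j
    have := congrFun (congrFun (wMat_plucker (v := genV) genW_isSymm) i) j
    rw [← smul_eq_mul, ← Matrix.smul_apply, ← this]
    fin_cases i <;> fin_cases j <;> rfl
  rintro _ ⟨s | s, rfl⟩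
  · induction s using Sym2.ind with
    | _ i j => exact hsmul _ (hV i j ▸ (vMat p i j).2)
  · induction s using Sym2.ind with
    | _ i j => exact hsmul _ (hW i j ▸ (wMat p i j).2)

theorem pluckerIdeal_eq_span : pluckerIdeal b = Ideal.span spinRelations := by
  refine le_antisymm (fun f hf => ?_) (span_spinRelations_le_pluckerIdeal b)
  let q := Ideal.Quotient.mkₐ ℂ (Ideal.span spinRelations)
  -- The straightening relations are derived from the quadrics alone, so they hold in the quotient
  -- by the ideal of the quadrics.
  have hP : IsStraight fun t => q (plucker genV genW t) := by
    have h1 : SpinRel (genV.map q) (genW.map q) := by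
      refine (spinRel_iff q.toRingHom).mpr fun r hr => ?_
      exact Ideal.Quotient.eq_zero_iff_mem.mpr (Ideal.subset_span hr)
    rw [funext fun t => plucker_map q genV genW t]
    exact h1.isStraight (genV_isSymm.map q) (genW_isSymm.map q)
  obtain ⟨F, rfl⟩ := aeval_plucker_surjective f
  obtain ⟨S, hS, hFS⟩ := exists_mem_standardSpan_aeval_eq hP F
  have hcomp : ∀ T, MvPolynomial.aeval (fun t => q (plucker genV genW t)) T =
      q (MvPolynomial.aeval (plucker genV genW) T) := fun T =>
    (MvPolynomial.comp_aeval_apply _ q T).symm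
  have hmem : MvPolynomial.aeval (plucker genV genW) F - MvPolynomial.aeval (plucker genV genW) S ∈
      Ideal.span spinRelations := by
    rw [hcomp, hcomp] at hFS
    exact Ideal.Quotient.eq.mp hFS
  have hSmem : MvPolynomial.aeval (plucker genV genW) S ∈ pluckerIdeal b := by
    have := (pluckerIdeal b).sub_mem hf (span_spinRelations_le_pluckerIdeal b hmem)
    rwa [sub_sub_cancel] at this
  have hS0 : S = 0 := by
    refine eq_zero_of_aeval_maxMinors_genMatrix_eq_zero hS (MvPolynomial.funext fun x => ?_)
    rw [map_zero, ← MvPolynomial.coe_aeval_eq_eval]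
    let M : Matrix (Fin 3) (Fin 6) ℂ := Matrix.of fun i j => x (toLex (i, j))
    have hM : genMatrix.map (MvPolynomial.aeval x) = M := by
      ext i j
      simp [genMatrix, M]
    -- The scalar `1 / 6` cancels the factor in `plucker_spin`, so `S` is evaluated exactly at the
    -- maximal minors of `M`.
    have h1 := hSmem _ ((mem_grassmannianCone_iff b).mpr ⟨1 / 6, bivectorTriple b M, rfl⟩)
    rw [aeval_plucker_genV_genW] at h1
    simp only [map_smul, pluckerCoord_ιMulti, coordMatrix_bivectorTriple, smul_eq_mul] at h1
    rw [RingHom.coe_coe, MvPolynomial.comp_aeval_apply, ← h1]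
    congr 2
    ext t
    rw [maxMinors, AlgHom.map_det, ← hM]
    ring_nf
    rfl
  rw [hS0, map_zero, sub_zero] at hmem
  exact hmem

/-! ### Points of the zero locus -/

theorem exists_aeval_spinCoords_eq (f : ⋀[ℂ]^3 (⋀[ℂ]^2 V) →ₗ[ℂ] ℂ) :
    ∃ ℓ : MvPolynomial CoordIdx ℂ, ∀ ω, MvPolynomial.aeval (spinCoords b ω) ℓ = f ω := by
  let E := LinearEquiv.ofBijective (spinCoords b)
    ⟨spinCoords_injective b, spinCoords_surjective b⟩
  refine ⟨∑ i, MvPolynomial.C (f (E.symm fun j => if i = j then 1 else 0)) * MvPolynomial.X i, fun ω => ?_⟩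
  have h : f ω = (f ∘ₗ E.symm.toLinearMap) (spinCoords b ω) := by
    change f ω = f (E.symm (E ω))
    rw [E.symm_apply_apply]
  rw [h, LinearMap.pi_apply_eq_sum_univ]
  simp only [map_sum, map_mul, MvPolynomial.aeval_C, MvPolynomial.aeval_X, smul_eq_mul,
    Algebra.algebraMap_self, RingHom.id_apply]
  refine Finset.sum_congr rfl fun i _ => ?_
  rw [mul_comm]
  rfl

/-- The matrix of the Plücker coordinates obtained from `J` by exchanging one index. -/
def exchangeMatrix (J : Fin 3 → Fin 6) (ω : ⋀[ℂ]^3 (⋀[ℂ]^2 V)) : Matrix (Fin 3) (Fin 6) ℂ :=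
  Matrix.of fun i j => pluckerCoord b (Function.update J i j) ω

/-- By Cramer's rule the exchange matrix of a decomposable trivector is `c` times the adjugate of
the `J`-block of `M`, times `M`. The determinant of the adjugate of a `3 × 3` matrix is the square
of the determinant. -/
theorem det_exchangeMatrix_ιMulti (J L : Fin 3 → Fin 6) (c : ℂ) (u : Fin 3 → ⋀[ℂ]^2 V) :
    ((exchangeMatrix b J (c • exteriorPower.ιMulti ℂ 3 u)).submatrix id L).det =
      pluckerCoord b J (c • exteriorPower.ιMulti ℂ 3 u) ^ 2 *
        pluckerCoord b L (c • exteriorPower.ιMulti ℂ 3 u) := by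
  set M := coordMatrix b u
  have h : (exchangeMatrix b J (c • exteriorPower.ιMulti ℂ 3 u)).submatrix id L =
      c • ((M.submatrix id J).adjugate * M.submatrix id L) := by
    ext i j
    rw [Matrix.submatrix_apply, exchangeMatrix, Matrix.of_apply, map_smul, pluckerCoord_ιMulti,
      Matrix.smul_apply]
    congr 1
    have h1 : M.submatrix id (Function.update J i (L j)) =
        (M.submatrix id J).updateCol i (fun k => M k (L j)) := by
      ext k l
      by_cases hl : l = i
      · subst hl; simp
      · simp [hl]
    change (M.submatrix id (Function.update J (id i) (L j))).det = _
    rw [id, h1, ← Matrix.cramer_apply, Matrix.cramer_eq_adjugate_mulVec]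
    rfl
  rw [h, Matrix.det_smul, Matrix.det_mul, Matrix.det_adjugate, map_smul, map_smul,
    pluckerCoord_ιMulti, pluckerCoord_ιMulti]
  simp only [Fintype.card_fin, smul_eq_mul]
  ring

/-- The identity is a cubic equation in the coordinates that holds on the cone, so it belongs to
`pluckerIdeal b` and holds on its whole zero locus. -/
theorem det_exchangeMatrix_of_mem {ω : ⋀[ℂ]^3 (⋀[ℂ]^2 V)}
    (hω : spinCoords b ω ∈ MvPolynomial.zeroLocus ℂ (pluckerIdeal b)) (J L : Fin 3 → Fin 6) :
    ((exchangeMatrix b J ω).submatrix id L).det = pluckerCoord b J ω ^ 2 * pluckerCoord b L ω := by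
  choose ℓ hℓ using fun K : Fin 3 → Fin 6 => exists_aeval_spinCoords_eq b (pluckerCoord b K)
  let N : Matrix (Fin 3) (Fin 3) (MvPolynomial CoordIdx ℂ) :=
    Matrix.of fun i j => ℓ (Function.update J i (L j))
  have key : ∀ ω, MvPolynomial.aeval (spinCoords b ω) (N.det - ℓ J ^ 2 * ℓ L) =
      ((exchangeMatrix b J ω).submatrix id L).det -
        pluckerCoord b J ω ^ 2 * pluckerCoord b L ω := by
    intro ω
    have hN : (MvPolynomial.aeval (spinCoords b ω)).mapMatrix N =
        (exchangeMatrix b J ω).submatrix id L := by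
      ext i j
      exact hℓ _ ω
    rw [map_sub, map_mul, map_pow, hℓ, hℓ, AlgHom.map_det, hN]
  rw [← sub_eq_zero, ← key]
  refine hω _ fun a ha => ?_
  obtain ⟨c, u, rfl⟩ := (mem_grassmannianCone_iff b).mp ha
  rw [key, det_exchangeMatrix_ιMulti, sub_self]

/-- Where some coordinate `p_J` is nonzero, the rows of the exchange matrix give three bivectors
whose product has the Plücker coordinates of `ω` multiplied by the square of `p_J`. -/
theorem exists_eq_smul_of_mem_zeroLocus {ω : ⋀[ℂ]^3 (⋀[ℂ]^2 V)}
    (hω : spinCoords b ω ∈ MvPolynomial.zeroLocus ℂ (pluckerIdeal b)) :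
    ∃ (c : ℂ) (u : Fin 3 → ⋀[ℂ]^2 V), ω = c • exteriorPower.ιMulti ℂ 3 u := by
  by_cases h0 : ω = 0
  · exact ⟨0, 0, by rw [h0, zero_smul]⟩
  obtain ⟨s, hs⟩ : ∃ s, pluckerCoord b (tri s) ω ≠ 0 := by
    by_contra! h
    exact h0 (eq_zero_of_pluckerCoord_eq_zero b h)
  refine ⟨(pluckerCoord b (tri s) ω ^ 2)⁻¹, bivectorTriple b (exchangeMatrix b (tri s) ω), ?_⟩
  rw [eq_inv_smul_iff₀ (pow_ne_zero 2 hs), ← sub_eq_zero]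
  refine eq_zero_of_pluckerCoord_eq_zero b fun t => ?_
  rw [map_sub, map_smul, pluckerCoord_ιMulti, coordMatrix_bivectorTriple,
    det_exchangeMatrix_of_mem b hω, smul_eq_mul, sub_self]

end

theorem mem_zeroLocus_iff_existsUnique {V : Type*} [AddCommGroup V] [Module ℂ V]
    (b : Module.Basis (Fin 4) ℂ V) {v w : Matrix (Fin 4) (Fin 4) ℂ} (hv : v.IsSymm)
    (hw : w.IsSymm) (h0 : (v, w) ≠ 0) :
    coords v w ∈ MvPolynomial.zeroLocus ℂ (pluckerIdeal b) ↔
      ∃! U : Submodule ℂ (⋀[ℂ]^2 V), Module.finrank ℂ U = 3 ∧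
        ∃ ω ∈ pluckerLine U, v = spinV b ω ∧ w = spinW b ω := by
  constructor
  · intro h
    obtain ⟨ω, hω⟩ := (range_spin b).ge (show (v, w) ∈ _ from ⟨hv, hw⟩)
    obtain ⟨rfl, rfl⟩ := Prod.ext_iff.mp hω
    obtain ⟨c, u, rfl⟩ := exists_eq_smul_of_mem_zeroLocus b h
    obtain ⟨U, hU, hmem⟩ := exists_mem_pluckerLine b c u
    refine ⟨U, ⟨hU, _, hmem, rfl, rfl⟩, ?_⟩
    rintro U' ⟨hU', ω', hω', h1, h2⟩
    obtain rfl := spin_injective b (Prod.ext h1 h2)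
    refine eq_of_mem_exteriorLine hU' hU (fun hz => h0 ?_) hω' hmem
    simp only [hz, map_zero]
    rfl
  · rintro ⟨U, ⟨hU, ω, hω, rfl, rfl⟩, -⟩
    exact MvPolynomial.zeroLocus_vanishingIdeal_le _ ⟨U, hU, ω, hω, rfl⟩

end DoubleSpin

end

theorem mainTheorem11 {V : Type*} [AddCommGroup V] [Module ℂ V]
    (b : Module.Basis (Fin 4) ℂ V) :
    -- `ω ↦ (v, w)` is a linear isomorphism onto the pairs of symmetric matrices
    (Function.Injective (fun ω : ⋀[ℂ]^3 (⋀[ℂ]^2 V) =>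
        (DoubleSpin.spinV b ω, DoubleSpin.spinW b ω)) ∧
      Set.range (fun ω : ⋀[ℂ]^3 (⋀[ℂ]^2 V) =>
        (DoubleSpin.spinV b ω, DoubleSpin.spinW b ω)) = {p | p.1.IsSymm ∧ p.2.IsSymm}) ∧
    -- and it is equivariant, with `GL(V)` acting by `S²V ⊗ det` and `S²V* ⊗ det²`
    (∀ (g : V ≃ₗ[ℂ] V) (G : Matrix (Fin 4) (Fin 4) ℂ) (ω : ⋀[ℂ]^3 (⋀[ℂ]^2 V)),
      G = LinearMap.toMatrix b b g.toLinearMap →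
      DoubleSpin.spinV b (exteriorPower.map 3 (exteriorPower.map 2 g.toLinearMap) ω) =
          G.det • (G * DoubleSpin.spinV b ω * Gᵀ) ∧
        DoubleSpin.spinW b (exteriorPower.map 3 (exteriorPower.map 2 g.toLinearMap) ω) =
          G.det ^ 2 • ((G⁻¹)ᵀ * DoubleSpin.spinW b ω * G⁻¹)) ∧
    -- the Plücker ideal is generated by the relations
    DoubleSpin.pluckerIdeal b = Ideal.span DoubleSpin.spinRelations ∧
    -- the points of its projective zero locus are the points of the Grassmannian
    (∀ v w : Matrix (Fin 4) (Fin 4) ℂ, v.IsSymm → w.IsSymm → (v, w) ≠ 0 →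
      (DoubleSpin.coords v w ∈ MvPolynomial.zeroLocus ℂ (DoubleSpin.pluckerIdeal b) ↔
        ∃! U : Submodule ℂ (⋀[ℂ]^2 V), Module.finrank ℂ U = 3 ∧
          ∃ ω ∈ DoubleSpin.pluckerLine U,
            v = DoubleSpin.spinV b ω ∧ w = DoubleSpin.spinW b ω)) ∧
    -- consequences for a point of the zero locus
    (∀ v w : Matrix (Fin 4) (Fin 4) ℂ, v.IsSymm → w.IsSymm →
      DoubleSpin.coords v w ∈ MvPolynomial.zeroLocus ℂ (DoubleSpin.pluckerIdeal b) →
        v.det = w.det ∧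
        (∃ c : ℂ, c ^ 2 = w.det ∧ v * w = c • (1 : Matrix (Fin 4) (Fin 4) ℂ)) ∧
        (v.rank ≠ 3 ∧ w.rank ≠ 3) ∧
        (v.rank = 2 ↔ w.rank = 2) ∧
        (v.rank ≤ 1 ↔ w.rank ≤ 1)) :=
  ⟨⟨DoubleSpin.spin_injective b, DoubleSpin.range_spin b⟩,
    fun g _ ω hG => hG ▸ DoubleSpin.spin_equivariant b g ω,
    DoubleSpin.pluckerIdeal_eq_span b,
    fun _ _ hv hw h0 => DoubleSpin.mem_zeroLocus_iff_existsUnique b hv hw h0,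
    fun _ _ hv hw h => DoubleSpin.SpinRel.consequences
      ((DoubleSpin.mem_zeroLocus_spinRelations_iff hv hw).mp
        (DoubleSpin.pluckerIdeal_eq_span b ▸ h)) hw⟩
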